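/- **Setting.** Let $\Bbbk$ be an algebraically closed field of characteristic zero, $G$ a connected affine algebraic group over $\Bbbk$ with Lie algebra $\mathfrak g$, and $V$ a finite-dimensional rational $G$-module. For a finite-dimensional vector space $W$, let $\mathrm{Mor}(V,W)$ be the $\Bbbk[V]$-module of polynomial maps $V\to W$, and let $$\hat\phi:\mathrm{Mor}(V,\mathfrak g)\to\mathrm{Mor}(V,V),\qquad \hat\phi(F)(v)=F(v)\cdot v .$$ Let $\pi_V:V\to V/\!\!/G=\mathrm{Spec}\,\Bbbk[V]^G$ be the quotient map and $\mathcal N=\pi_V^{-1}(\pi_V(0))$ the null-cone. Let $\mathcal N_{reg}$ be the set of points of $\mathcal N$ whose $G$-orbit has maximal dimension among the $G$-orbits in $\mathcal N$. Codimension means difference of dimensions, and the empty set has codimension $\infty$. **Proposition.** Assume that 1. $\Bbbk[V]^G$ is a polynomial algebra, freely generated by some $f_1,\dots,f_l$; 2. $\mathrm{Ker}\,\hat\phi$ is a free $\Bbbk[V]$-module with a basis $F_1,\dots,F_m$ consisting of $G$-equivariant morphisms $V\to\mathfrak g$ (for the adjoint action on $\mathfrak g$); 3. a generic fibre of $\pi_V$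 is a (closed) $G$-orbit, i.e. $\pi_V^{-1}(\pi_V(v))=G\cdot v$ for all $v$ in a dense open subset of $V$; 4. $\mathcal N$ contains finitely many $G$-orbits. For $i\ge 0$ put $$\mathfrak X_i=\{v\in V\mid \dim\mathrm{span}\{F_1(v),\dots,F_m(v)\}\le m-i\},\qquad \mathfrak X_i(\mathcal N)=\mathfrak X_i\cap\mathcal N .$$ Choose a basis $e_1,\dots,e_n$ of $\mathfrak g$, write $F_j(v)=\sum_{i} F_{ij}(v)e_i$, and let $I_t$ be the ideal of $\Bbbk[V]$ generated by the $t\times t$ minors of the $n\times m$ matrix $(F_{ij})$. If $$(\clubsuit)\qquad \mathrm{codim}_{\mathcal N}\,\mathfrak X_i(\mathcal N)\ge i+1\quad\text{for any } i\ge 1,$$ then condition $(\mathcal F_2)$ is satisfied: $$\mathrm{ht}\, I_t\ge m-t+3\quad\text{for } 1\le t\le m$$ (the unit ideal has height $\infty$). Moreover, under assumptions 1–4, condition $(\clubsuit)$ is equivalent to the following: $\mathcal N_{reg}\subset \mathfrak X_0(\mathcal N)\setminus\mathfrak X_1(\mathcal N)$ (that is, $F_1(v),\dots,F_m(v)$ are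 linearly independent for every $v\in\mathcal N_{reg}$), and for any $v\in\mathcal N\setminus\mathcal N_{reg}$, $$\dim\mathrm{span}\{F_1(v),\dots,F_m(v)\}+\mathrm{codim}_{\mathcal N}\,G\cdot v\ge m+1 .$$ -/

import Mathlib

open scoped TensorProduct

noncomputable section

namespace AlgRep

/-! ### Affine algebraic groups, their Lie algebras and the adjoint action

An affine algebraic group `G` over an algebraically closed field `k` is given by its algebra of
regular functions `A = k[G]`, a reduced commutative Hopf algebra of finite type.  The elements of
`G` are the `k`-algebra homomorphisms `A → k`, with the convolution product. -/

section Group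

variable (k A : Type*) [Field k] [CommRing A] [HopfAlgebra k A]

/-- The group `G` of `k`-points; the group structure is Mathlib's convolution group. -/
abbrev Points := WithConv (A →ₐ[k] k)

/-- The Lie algebra of `G` (the tangent space at the identity): linear functionals `x` on `k[G]`
with `x (a b) = a(1) x(b) + x(a) b(1)`, where `a(1)` is the counit. -/
def lieAlg : Submodule k (Module.Dual k A) where
  carrier := {x | ∀ a b : A,
    x (a * b) = Coalgebra.counit (R := k) a * x b + x a * Coalgebra.counit (R := k) b}
  add_mem' := by
    intro x y hx hy a b
    simp only [LinearMap.add_apply, hx a b, hy a b]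
    ring
  zero_mem' := by
    intro a b
    simp
  smul_mem' := by
    intro c x hx a b
    simp only [LinearMap.smul_apply, hx a b, smul_eq_mul]
    ring

variable {k A}

/-- The point `g` viewed as a linear functional (evaluation at `g`). -/
def ev (g : Points k A) : Module.Dual k A := g.ofConv.toLinearMap

/-- The convolution product of linear functionals on `k[G]`, `(x * y)(a) = ∑ x(a₁) y(a₂)`. -/
def conv (x y : Module.Dual k A) : Module.Dual k A :=
  (WithConv.toConv x * WithConv.toConv y).ofConv

theorem conv_left_skew (g : Points k A) (φ D : Module.Dual k A)
    (h : ∀ a b : A, D (a * b) = φ a * D b + D a * φ b) (a b : A) :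
    conv (ev g) D (a * b) = conv (ev g) φ a * conv (ev g) D b
      + conv (ev g) D a * conv (ev g) φ b := by
  have key : ∀ T U : A ⊗[k] A,
      LinearMap.mul' k k (TensorProduct.map (ev g) D (T * U)) =
        LinearMap.mul' k k (TensorProduct.map (ev g) φ T) *
          LinearMap.mul' k k (TensorProduct.map (ev g) D U) +
        LinearMap.mul' k k (TensorProduct.map (ev g) D T) *
          LinearMap.mul' k k (TensorProduct.map (ev g) φ U) := by
    intro T U
    induction T with
    | zero => simp
    | add T₁ T₂ h₁ h₂ => simp only [add_mul, map_add, h₁, h₂]; ring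
    | tmul a₁ a₂ =>
      induction U with
      | zero => simp
      | add U₁ U₂ h₁ h₂ => simp only [mul_add, map_add, h₁, h₂]; ring
      | tmul b₁ b₂ =>
        have hg : ev g (a₁ * b₁) = ev g a₁ * ev g b₁ := map_mul g.ofConv a₁ b₁
        simp only [Algebra.TensorProduct.tmul_mul_tmul, TensorProduct.map_tmul,
          LinearMap.mul'_apply, h, hg]
        ring
  have := key (Coalgebra.comul (R := k) a) (Coalgebra.comul (R := k) b)
  rw [← Bialgebra.comul_mul] at this
  exact this

theorem conv_right_skew (g : Points k A) (φ D : Module.Dual k A)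
    (h : ∀ a b : A, D (a * b) = φ a * D b + D a * φ b) (a b : A) :
    conv D (ev g) (a * b) = conv φ (ev g) a * conv D (ev g) b
      + conv D (ev g) a * conv φ (ev g) b := by
  have key : ∀ T U : A ⊗[k] A,
      LinearMap.mul' k k (TensorProduct.map D (ev g) (T * U)) =
        LinearMap.mul' k k (TensorProduct.map φ (ev g) T) *
          LinearMap.mul' k k (TensorProduct.map D (ev g) U) +
        LinearMap.mul' k k (TensorProduct.map D (ev g) T) *
          LinearMap.mul' k k (TensorProduct.map φ (ev g) U) := by
    intro T U
    induction T with
    | zero => simp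
    | add T₁ T₂ h₁ h₂ => simp only [add_mul, map_add, h₁, h₂]; ring
    | tmul a₁ a₂ =>
      induction U with
      | zero => simp
      | add U₁ U₂ h₁ h₂ => simp only [mul_add, map_add, h₁, h₂]; ring
      | tmul b₁ b₂ =>
        have hg : ev g (a₂ * b₂) = ev g a₂ * ev g b₂ := map_mul g.ofConv a₂ b₂
        simp only [Algebra.TensorProduct.tmul_mul_tmul, TensorProduct.map_tmul,
          LinearMap.mul'_apply, h, hg]
        ring
  have := key (Coalgebra.comul (R := k) a) (Coalgebra.comul (R := k) b)
  rw [← Bialgebra.comul_mul] at this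
  exact this

theorem conv_ev_counit_ev_inv (g : Points k A) :
    conv (conv (ev g) (Coalgebra.counit (R := k))) (ev g⁻¹) = Coalgebra.counit (R := k) := by
  have h1 : (WithConv.toConv (Coalgebra.counit (R := k) (A := A)) : WithConv (A →ₗ[k] k)) = 1 :=
    rfl
  have h2 : conv (ev g) (Coalgebra.counit (R := k)) = ev g := by
    unfold conv
    rw [h1, mul_one]
  rw [h2]
  have h3 := AlgHom.toLinearMap_convMul g g⁻¹
  rw [mul_inv_cancel] at h3
  exact congrArg WithConv.ofConv h3.symm

/-- The adjoint action `Ad(g) x = g x g⁻¹` of `G` on its Lie algebra (the product is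
convolution), that is, the differential at the identity of `h ↦ g h g⁻¹`. -/
def Ad (g : Points k A) (x : lieAlg k A) : lieAlg k A :=
  ⟨conv (conv (ev g) (x : Module.Dual k A)) (ev g⁻¹), by
    intro a b
    have h := conv_right_skew g⁻¹ _ _ (conv_left_skew g _ _ x.2) a b
    rwa [conv_ev_counit_ev_inv] at h⟩

end Group

/-! ### Rational representations -/

/-- A rational `G`-module structure on `V`: a coaction `V → V ⊗ k[G]`,
`v ↦ ∑ vᵢ ⊗ aᵢ`, corresponding to `g · v = ∑ aᵢ(g) vᵢ`. -/
structure RationalRep (k A V : Type*) [Field k] [CommRing A] [HopfAlgebra k A]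
    [AddCommGroup V] [Module k V] where
  coact : V →ₗ[k] V ⊗[k] A
  counit_coact : ∀ v : V,
    TensorProduct.rid k V ((Coalgebra.counit (R := k) (A := A)).lTensor V (coact v)) = v
  coassoc : ∀ v : V,
    TensorProduct.assoc k V A A (coact.rTensor A (coact v)) =
      (Coalgebra.comul (R := k) (A := A)).lTensor V (coact v)

section Poly

variable (k V W : Type*) [Field k] [AddCommGroup V] [Module k V] [AddCommGroup W] [Module k W]

/-- The algebra `k[V]` of polynomial functions on `V`: the functions generated by the linear
functionals. -/
def PolyFun : Subalgebra k (V → k) :=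
  Algebra.adjoin k (Set.range fun l : Module.Dual k V => (l : V → k))

/-- `Mor(V, W)`: the `k[V]`-module of polynomial maps `V → W` (all of whose composites with
linear functionals on `W` are polynomial functions; used for finite-dimensional `W`). -/
def Mor : Submodule (PolyFun k V) (V → W) where
  carrier := {F | ∀ l : Module.Dual k W, (fun v => l (F v)) ∈ PolyFun k V}
  add_mem' := by
    intro F F' hF hF' l
    have : (fun v => l ((F + F') v)) = (fun v => l (F v)) + fun v => l (F' v) := by
      ext v; simp
    rw [this]
    exact add_mem (hF l) (hF' l)
  zero_mem' := by
    intro l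
    have : (fun v => l ((0 : V → W) v)) = 0 := by ext v; simp
    rw [this]
    exact zero_mem _
  smul_mem' := by
    intro p F hF l
    have : (fun v => l ((p • F) v)) = (p : V → k) * fun v => l (F v) := by
      ext v
      have : (p • F) v = (p : V → k) v • F v := rfl
      simp [this]
    rw [this]
    exact mul_mem p.2 (hF l)

instance morModule : Module (PolyFun k V) (Mor k V W) := (Mor k V W).module

instance morSMul : SMul (PolyFun k V) (Mor k V W) := (morModule k V W).toSMul

variable {k V}

/-- Zariski closed subsets of `V`. -/
def IsZariskiClosed (Z : Set V) : Prop :=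
  ∃ T : Set (PolyFun k V), Z = {v | ∀ p ∈ T, (p : V → k) v = 0}

variable (k)

/-- The ideal of all polynomial functions vanishing on `S`. -/
def vanishing (S : Set V) : Ideal (PolyFun k V) where
  carrier := {p | ∀ v ∈ S, (p : V → k) v = 0}
  add_mem' := by
    intro p q hp hq v hv
    simp [hp v hv, hq v hv]
  zero_mem' := by
    intro v _
    rfl
  smul_mem' := by
    intro p q hq v hv
    simp [hq v hv]

/-- The dimension of a subset `S ⊆ V`, i.e. of its Zariski closure: the Krull dimension of the
coordinate ring `k[V] / I(S)`.  It is `⊥` when `S` is empty. -/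
def zdim (S : Set V) : WithBot ℕ∞ := ringKrullDim (PolyFun k V ⧸ vanishing k S)

/-- The codimension `codim_X Y = dim X - dim Y` for `Y ⊆ X ⊆ V`, written as the supremum of the
`c` with `dim Y + c ≤ dim X`; it is `∞` when `Y` is empty. -/
def codim (X Y : Set V) : ℕ∞ :=
  ⨆ c ∈ {c : ℕ | zdim k Y + (c : WithBot ℕ∞) ≤ zdim k X}, (c : ℕ∞)

end Poly

section Rep

variable {k A V : Type*} [Field k] [CommRing A] [HopfAlgebra k A] [AddCommGroup V] [Module k V]
  (ρ : RationalRep k A V)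

/-- The action on `V` of a linear functional `x` on `k[G]`: `x · v = ∑ x(aᵢ) vᵢ` if the coaction
sends `v` to `∑ vᵢ ⊗ aᵢ`.  For `x ∈ G` this is the action of `G`, for `x` in the Lie algebra it is
the differential of that action. -/
def dualAct : Module.Dual k A →ₗ[k] V →ₗ[k] V where
  toFun x := (TensorProduct.rid k V).toLinearMap ∘ₗ x.lTensor V ∘ₗ ρ.coact
  map_add' x y := by
    ext v; simp [LinearMap.lTensor_add]
  map_smul' c x := by
    ext v; simp [LinearMap.lTensor_smul]

/-- The action `v ↦ g · v` of `g ∈ G`. -/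
def act (g : Points k A) : V →ₗ[k] V := dualAct ρ (ev g)

/-- The action `v ↦ x · v` of an element `x` of the Lie algebra of `G`. -/
def lieAct : lieAlg k A →ₗ[k] V →ₗ[k] V := dualAct ρ ∘ₗ (lieAlg k A).subtype

/-- The orbit `G · v`. -/
def orbit (v : V) : Set V := Set.range fun g : Points k A => act ρ g v

/-- The algebra of invariants `k[V]^G`. -/
def invariants : Subalgebra k (PolyFun k V) where
  carrier := {p | ∀ (g : Points k A) (v : V), (p : V → k) (act ρ g v) = (p : V → k) v}
  mul_mem' := by
    intro p q hp hq g v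
    simp [hp g v, hq g v]
  add_mem' := by
    intro p q hp hq g v
    simp [hp g v, hq g v]
  algebraMap_mem' := by
    intro c g v
    rfl

/-- The quotient map `π_V : V → V // G = Spec k[V]^G`, with values in the `k`-points of the
target: `v` goes to evaluation at `v`. -/
def quotientMap (v : V) : invariants ρ →ₐ[k] k :=
  (Pi.evalAlgHom k (fun _ : V => k) v).comp ((PolyFun k V).val.comp (invariants ρ).val)

/-- The fibre of `π_V` through `v`. -/
def fibre (v : V) : Set V := quotientMap ρ ⁻¹' {quotientMap ρ v}

/-- The null-cone: the fibre of `π_V` through the origin. -/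
def nullCone : Set V := fibre ρ 0

/-- `G`-regular points of `X`: those whose orbit has maximal dimension among the orbits of points
of `X`. -/
def regularPoints (X : Set V) : Set V :=
  {v | v ∈ X ∧ ∀ w ∈ X, zdim k (orbit ρ w) ≤ zdim k (orbit ρ v)}

/-- A generic fibre of `π_V` is a `G`-orbit: `π_V⁻¹(π_V(v)) = G · v` for all `v` in a non-empty
(hence dense) Zariski open subset of `V`. -/
def GenericFibreIsOrbit : Prop :=
  ∃ Z : Set V, IsZariskiClosed (k := k) Z ∧ Z ≠ Set.univ ∧ ∀ v ∉ Z, fibre ρ v = orbit ρ v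

theorem phi_mem [FiniteDimensional k V] (F : Mor k V (lieAlg k A)) :
    (fun v => lieAct ρ ((F : V → lieAlg k A) v) v) ∈ Mor k V V := by
  intro l
  let b := Module.finBasis k V
  have : (fun v => l (lieAct ρ ((F : V → lieAlg k A) v) v)) =
      ∑ j, (fun v => b.coord j v) * fun v =>
        (l ∘ₗ (lieAct ρ).flip (b j)) ((F : V → lieAlg k A) v) := by
    ext v
    simp only [Finset.sum_apply, Pi.mul_apply, LinearMap.comp_apply, LinearMap.flip_apply,
      Module.Basis.coord_apply]
    have h : ∀ L : V →ₗ[k] k, L v = ∑ j, b.repr v j * L (b j) := by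
      intro L
      conv_lhs => rw [← b.sum_repr v]
      simp only [map_sum, map_smul, smul_eq_mul]
    exact h (l ∘ₗ lieAct ρ ((F : V → lieAlg k A) v))
  rw [this]
  refine sum_mem fun j _ => mul_mem ?_ (F.2 _)
  exact Algebra.subset_adjoin ⟨b.coord j, rfl⟩

/-- The `k[V]`-linear map `φ̂ : Mor(V, 𝔤) → Mor(V, V)`, `φ̂(F)(v) = F(v) · v`. -/
def phiHat [FiniteDimensional k V] : Mor k V (lieAlg k A) →ₗ[PolyFun k V] Mor k V V where
  toFun F := ⟨fun v => lieAct ρ ((F : V → lieAlg k A) v) v, phi_mem ρ F⟩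
  map_add' F F' := by
    ext v; simp
  map_smul' p F := by
    ext v
    change lieAct ρ ((p : V → k) v • (F : V → lieAlg k A) v) v =
      (p : V → k) v • lieAct ρ ((F : V → lieAlg k A) v) v
    simp

/-- `F ∈ Mor_G(V, 𝔤)`: `F(g · v) = Ad(g) F(v)`. -/
def IsEquivariant (F : Mor k V (lieAlg k A)) : Prop :=
  ∀ (g : Points k A) (v : V),
    (F : V → lieAlg k A) (act ρ g v) = Ad g ((F : V → lieAlg k A) v)

end Rep

section Fitting

variable {k V W : Type*} [Field k] [AddCommGroup V] [Module k V] [AddCommGroup W] [Module k W]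
  {m n : ℕ}

/-- `dim span {F₁(v), …, F_m(v)}`. -/
def spanDim (F : Fin m → Mor k V W) (v : V) : ℕ :=
  Module.finrank k (Submodule.span k (Set.range fun j => (F j : V → W) v))

/-- The stratum `𝔛ᵢ = {v | dim span {F₁(v), …, F_m(v)} ≤ m - i}`. -/
def stratum (F : Fin m → Mor k V W) (i : ℕ) : Set V := {v | spanDim F v + i ≤ m}

/-- The `n × m` matrix of polynomial functions with `F_j(v) = ∑ᵢ B_ij(v) eᵢ`. -/
def coeffMatrix (e : Module.Basis (Fin n) k W) (F : Fin m → Mor k V W) :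
    Matrix (Fin n) (Fin m) (PolyFun k V) :=
  Matrix.of fun i j => ⟨fun v => e.coord i ((F j : V → W) v), (F j).2 (e.coord i)⟩

/-- The ideal generated by the `t × t` minors of a matrix. -/
def minorIdeal {R : Type*} [CommRing R] (B : Matrix (Fin n) (Fin m) R) (t : ℕ) : Ideal R :=
  Ideal.span {x | ∃ (r : Fin t → Fin n) (c : Fin t → Fin m), x = (B.submatrix r c).det}

/-- Condition `(𝓕_d)` on an `n × m` matrix: `ht I_t ≥ m - t + 1 + d` for `1 ≤ t ≤ m`
(the unit ideal has height `∞`). -/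
def ConditionF {R : Type*} [CommRing R] (d : ℕ) (B : Matrix (Fin n) (Fin m) R) : Prop :=
  ∀ t : ℕ, 1 ≤ t → t ≤ m → ((m - t + 1 + d : ℕ) : ℕ∞) ≤ (minorIdeal B t).height

/-- `𝔛ᵢ(N) = 𝔛ᵢ ∩ N`, where `N` is the null-cone. -/
def nullStratum {A : Type*} [CommRing A] [HopfAlgebra k A] (ρ : RationalRep k A V)
    (F : Fin m → Mor k V W) (i : ℕ) : Set V := stratum F i ∩ nullCone ρ

end Fitting

end AlgRep

end

open AlgRep

/-! For `(𝓕₂)`, take a minimal prime `Q` of `I_t`, put `i = m - t + 1`, and let `Z ⊆ 𝔛ᵢ` be its zero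
set. The goal is `ht Q ≥ i + 2`, obtained from an upper bound on `dim Z`.

Restricting the quotient map to `Z` gives `dim Z ≤ dim closure(π(Z)) + dim (Z ∩ N)`, provided that
`0 ∈ Z`. This holds since `Ker φ̂` is stable under `F ↦ F(t ·)`: the strata are cones, and each
component of a cone contains the origin (`Ideal.apply_zero_mem_of_mem_minimalPrimes`).

The base loses one dimension. The `F_j` are independent at a generic point, the rank is constant on
orbits, and generic fibres are single orbits. If `π(Z)` were dense, Chevalley's theorem would place
a point of `Z` on an orbit of full rank. So `Q` contains a non-zero invariant
(`exists_invariant_ne_zero_mem_of_degenerate`) and `dim closure(π(Z)) ≤ l - 1`.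

For the fibre, the codimension hypothesis gives `dim (Z ∩ N) ≤ dim N - (i + 1)`. Moreover `dim N ≤
dim V - l`: the null-cone is a finite union of orbits, `dim G·w ≤ dim 𝔤·w` (`zdim_orbit_le`), and
`dim 𝔤·w ≤ dim V - l` because the differentials of the `f_j` are generically independent and
annihilate `𝔤·v` (`finrank_lieOrbit_add_le`). Altogether `dim Z ≤ dim V - (i + 2)`, which `dim V ≤
ht Q + dim k[V]/Q` turns into the height bound.

The equivalence is bookkeeping with finitely many orbits: each stratum of `N` is a finite union of
orbits, so the codimension condition can be tested orbit by orbit, the decisive index at `v` being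
`i = m - dim span`. -/

noncomputable section

/-! ### Going down, heights and the dimension formula for affine domains. -/

open scoped Pointwise

/-- Going down for an integral extension of a normal domain that embeds into a Galois closure. -/
theorem Algebra.HasGoingDown.of_isInvariant {R T : Type*} [CommRing R] [CommRing T] [Algebra R T]
    (G : Type*) [Group G] [Finite G] [MulSemiringAction G T] [SMulCommClass G R T]
    [Algebra.IsInvariant R T G] [FaithfulSMul R T] : Algebra.HasGoingDown R T where
  exists_ideal_le_liesOver_of_lt {p} _ Q _ hlt := by
    have := Algebra.IsInvariant.isIntegral R T G
    obtain ⟨P₀, -, hP₀, hP₀p⟩ := Ideal.exists_ideal_over_prime_of_isIntegral p (⊥ : Ideal T)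
      (by simp [← RingHom.ker_eq_comap_bot])
    obtain ⟨Q₀, hle, hQ₀, hQ₀q⟩ := Ideal.exists_ideal_over_prime_of_isIntegral_of_isPrime
      (Q.under R) P₀ (hP₀p.trans_le hlt.le)
    -- Primes over the same prime are conjugate, so the pair `P₀ ≤ Q₀` built by going up can be
    -- moved to end in `Q`.
    obtain ⟨g, hg⟩ := Algebra.IsInvariant.exists_smul_of_under_eq R T G Q₀ Q hQ₀q
    have hp : P₀.LiesOver p := ⟨hP₀p.symm⟩
    refine ⟨g • P₀, ?_, hP₀.smul g, hp.smul g⟩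
    rw [hg]
    exact Ideal.pointwise_smul_le_pointwise_smul_iff.mpr hle

/-- A prime of `S` lifts to `T` by integrality; the prime found below the lift in `T` contracts to
the one wanted in `S`. -/
theorem Algebra.HasGoingDown.of_isIntegral_tower (R S T : Type*) [CommRing R] [CommRing S]
    [CommRing T] [Algebra R S] [Algebra S T] [Algebra R T] [IsScalarTower R S T]
    [Algebra.IsIntegral S T] [FaithfulSMul S T] [Algebra.HasGoingDown R T] :
    Algebra.HasGoingDown R S where
  exists_ideal_le_liesOver_of_lt {p} _ Q _ hlt := by
    obtain ⟨Q', -, hQ', hQ'Q⟩ := Ideal.exists_ideal_over_prime_of_isIntegral Q (⊥ : Ideal T)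
      (by simp [← RingHom.ker_eq_comap_bot])
    have h1 : Q'.LiesOver Q := ⟨hQ'Q.symm⟩
    have h2 : Q'.LiesOver (Q.under R) := .trans Q' Q (Q.under R)
    obtain ⟨P', hle, hP', hp⟩ := Ideal.exists_ideal_le_liesOver_of_le Q' hlt.le
    refine ⟨P'.under S, ?_, inferInstance, ⟨?_⟩⟩
    · rw [Q'.over_def Q]
      exact Ideal.comap_mono hle
    · rw [P'.over_def p, Ideal.under_under]

/-- Going down for integral extensions of a normal domain of characteristic zero. -/
theorem Algebra.HasGoingDown.of_isIntegrallyClosed (R S : Type*) [CommRing R] [IsDomain R]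
    [IsIntegrallyClosed R] [CharZero R] [CommRing S] [IsDomain S] [Algebra R S]
    [FaithfulSMul R S] [Module.Finite R S] : Algebra.HasGoingDown R S := by
  let K := FractionRing R
  let E := FractionRing S
  let := FractionRing.liftAlgebra R E
  have : FiniteDimensional K E := inferInstance
  have : CharZero K := charZero_of_injective_algebraMap (IsFractionRing.injective R K)
  -- In characteristic zero the normal closure is Galois over `K`. As `R` is normal, it is the ring
  -- of invariants of its integral closure `T` in `L`, and `S` embeds into `T`.
  let L := IntermediateField.normalClosure K E (AlgebraicClosure E)
  have : Algebra.IsAlgebraic K L := inferInstance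
  have : IsGalois K L := ⟨⟩
  let : Algebra R L := ((algebraMap K L).comp (algebraMap R K)).toAlgebra
  have : IsScalarTower R K L := .of_algebraMap_eq' rfl
  let T := integralClosure R L
  have : IsFractionRing T L := integralClosure.isFractionRing_of_finite_extension K L
  let := IsIntegralClosure.MulSemiringAction R K L T
  have := Algebra.isInvariant_of_isGalois R K L T
  have : SMulCommClass Gal(L/K) R T :=
    ⟨fun g r t => map_smul (galRestrict R K L T g) r t⟩
  let : Algebra S L := ((algebraMap E L).comp (algebraMap S E)).toAlgebra
  have : IsScalarTower S E L := .of_algebraMap_eq' rfl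
  have : IsScalarTower R S L := .of_algebraMap_eq fun r => by
    rw [IsScalarTower.algebraMap_apply R K L, IsScalarTower.algebraMap_apply S E L,
      IsScalarTower.algebraMap_apply K E L, ← IsScalarTower.algebraMap_apply R S E,
      ← IsScalarTower.algebraMap_apply R K E]
  let φ : S →ₐ[R] T := IsIntegralClosure.lift R T L
  let : Algebra S T := φ.toRingHom.toAlgebra
  have : IsScalarTower R S T := .of_algebraMap_eq' φ.comp_algebraMap.symm
  have hST : IsScalarTower S T L := .of_algebraMap_eq fun s =>
    (IsIntegralClosure.algebraMap_lift R T L s).symm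
  have : FaithfulSMul S T := by
    refine (faithfulSMul_iff_algebraMap_injective S T).mpr (.of_comp (f := algebraMap T L) ?_)
    rw [← RingHom.coe_comp, ← IsScalarTower.algebraMap_eq]
    exact (algebraMap E L).injective.comp (IsFractionRing.injective S E)
  have : FaithfulSMul R T := .trans R S T
  have : Algebra.IsIntegral S T := .tower_top R
  have : Algebra.HasGoingDown R T := .of_isInvariant Gal(L/K)
  exact .of_isIntegral_tower R S T

theorem ringKrullDim_le_of_isIntegral (R S : Type*) [CommRing R] [CommRing S] [Algebra R S]
    [Algebra.IsIntegral R S] : ringKrullDim S ≤ ringKrullDim R :=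
  Order.krullDim_le_of_strictMono (PrimeSpectrum.comap (algebraMap R S))
    fun _ _ h => Ideal.IsIntegral.comap_lt_comap h

theorem ringKrullDim_eq_of_isIntegral (R S : Type*) [CommRing R] [CommRing S] [Algebra R S]
    [Algebra.IsIntegral R S] [FaithfulSMul R S] : ringKrullDim S = ringKrullDim R := by
  refine le_antisymm (ringKrullDim_le_of_isIntegral R S) (iSup_le fun l => ?_)
  obtain ⟨Q, -, hQ, hQl⟩ := Ideal.exists_ideal_over_prime_of_isIntegral l.head.asIdeal
    (⊥ : Ideal S) (by simp [← RingHom.ker_eq_comap_bot])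
  have : Q.LiesOver l.head.asIdeal := ⟨hQl.symm⟩
  obtain ⟨L, hL, -⟩ := Ideal.exists_ltSeries_of_hasGoingUp l Q
  rw [← hL]
  exact Order.LTSeries.length_le_krullDim L

theorem MvPolynomial.ringKrullDim_fin (k : Type*) [Field k] (d : ℕ) :
    ringKrullDim (MvPolynomial (Fin d) k) = d := by
  rw [MvPolynomial.ringKrullDim_of_isNoetherianRing, ringKrullDim_eq_zero_of_field]
  simp

/-- Every maximal ideal of a polynomial ring over a field has height the number of variables. -/
theorem MvPolynomial.height_of_isMaximal {k : Type*} [Field k] (d : ℕ)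
    (P : Ideal (MvPolynomial (Fin d) k)) [P.IsMaximal] : P.height = d := by
  induction d with
  | zero =>
    have h := Ideal.height_le_ringKrullDim_of_ne_top (I := P) Ideal.IsPrime.ne_top'
    rw [MvPolynomial.ringKrullDim_fin] at h
    simpa using h
  | succ d ih =>
    let e := MvPolynomial.finSuccEquiv k d
    let Q : Ideal (Polynomial (MvPolynomial (Fin d) k)) := P.map e
    have hQ : Q.IsMaximal := Ideal.map_isMaximal_of_equiv e
    have h1 : Q.height = P.height := (e.toRingEquiv).height_map P
    have : (Q.under (MvPolynomial (Fin d) k)).IsMaximal :=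
      Polynomial.isMaximal_comap_C_of_isJacobsonRing Q
    have : Q.LiesOver (Q.under (MvPolynomial (Fin d) k)) := ⟨rfl⟩
    rw [← h1, Polynomial.height_eq_height_add_one (Q.under (MvPolynomial (Fin d) k)) Q, ih]
    simp

theorem Ideal.height_le_of_liesOver_of_hasGoingDown {R S : Type*} [CommRing R] [CommRing S]
    [IsNoetherianRing R] [IsNoetherianRing S] [Algebra R S]
    [Algebra.HasGoingDown R S] (p : Ideal R) [p.IsPrime]
    (P : Ideal S) [P.IsPrime] [P.LiesOver p] : p.height ≤ P.height := by
  rw [Ideal.height_eq_height_add_of_liesOver_of_hasGoingDown p P]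
  exact le_self_add

/-- Maximal ideals of an affine domain have height equal to its dimension. -/
theorem Ideal.height_eq_ringKrullDim_of_isMaximal (k : Type*) {S : Type*} [Field k] [CharZero k]
    [CommRing S] [IsDomain S] [Algebra k S] [Algebra.FiniteType k S] (P : Ideal S) [P.IsMaximal] :
    (P.height : WithBot ℕ∞) = ringKrullDim S := by
  obtain ⟨d, g, hg, hfin⟩ := exists_finite_inj_algHom_of_fg k S
  algebraize [g.toRingHom]
  have : Module.Finite (MvPolynomial (Fin d) k) S := hfin
  have : FaithfulSMul (MvPolynomial (Fin d) k) S :=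
    (faithfulSMul_iff_algebraMap_injective _ _).mpr hg
  have := Algebra.HasGoingDown.of_isIntegrallyClosed (MvPolynomial (Fin d) k) S
  have : IsNoetherianRing S := Algebra.FiniteType.isNoetherianRing k S
  have : (P.under (MvPolynomial (Fin d) k)).IsMaximal :=
    Ideal.isMaximal_comap_of_isIntegral_of_isMaximal P
  refine le_antisymm (Ideal.height_le_ringKrullDim_of_ne_top Ideal.IsPrime.ne_top') ?_
  have h := Ideal.height_le_of_liesOver_of_hasGoingDown (P.under (MvPolynomial (Fin d) k)) P
  rw [MvPolynomial.height_of_isMaximal] at h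
  rw [ringKrullDim_eq_of_isIntegral (MvPolynomial (Fin d) k) S,
    MvPolynomial.ringKrullDim_fin]
  simpa using WithBot.coe_le_coe.mpr h

/-- In a domain the zero prime lies strictly below every prime containing `I ≠ ⊥`, so a chain pulled
back from the quotient gains one link. -/
theorem Ideal.height_add_one_le_height_comap_quotientMk {R : Type*} [CommRing R] [IsDomain R]
    [IsNoetherianRing R] {I : Ideal R} (hI : I ≠ ⊥) (Q : Ideal (R ⧸ I)) [Q.IsPrime] :
    Q.height + 1 ≤ (Q.comap (Ideal.Quotient.mk I)).height := by
  obtain ⟨l, hl, hlen⟩ := Q.exists_ltSeries_length_eq_height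
  let l' := l.map (PrimeSpectrum.comap (Ideal.Quotient.mk I)) fun p q (h : p < q) =>
    lt_of_le_of_ne (Ideal.comap_mono (le_of_lt h)) fun he => h.ne (PrimeSpectrum.ext
      (Ideal.comap_injective_of_surjective _ Ideal.Quotient.mk_surjective
        (congrArg PrimeSpectrum.asIdeal he)))
  have hlt : (⊥ : PrimeSpectrum R) < l'.head := by
    refine bot_lt_iff_ne_bot.mpr fun h => hI ?_
    have h2 : I ≤ l'.head.asIdeal := by
      refine Ideal.mk_ker.symm.trans_le ?_
      exact Ideal.comap_mono bot_le
    rw [h] at h2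
    exact le_bot_iff.mp h2
  have h := Order.length_le_height_last (p := l'.cons ⊥ hlt)
  have hlast : (l'.cons ⊥ hlt).last =
      PrimeSpectrum.comap (Ideal.Quotient.mk I) ⟨Q, inferInstance⟩ := by
    rw [RelSeries.last_cons, ← hl]
    rfl
  rw [hlast, ← PrimeSpectrum.height_eq_orderHeight] at h
  rw [← hlen]
  exact (by simp [l']; rfl : (l.length : ℕ∞) + 1 = ((l'.cons ⊥ hlt).length : ℕ∞)).trans_le h

/-- Noether normalization transfers the dimension formula: contraction to the polynomial ring keeps
the dimension of the quotient by integrality, and cannot raise the height by going down. -/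
theorem ringKrullDim_le_height_add_of_mvPolynomial {k : Type*} [Field k] [CharZero k] (d : ℕ)
    (h : ∀ Q : Ideal (MvPolynomial (Fin d) k), Q.IsPrime →
      (d : WithBot ℕ∞) ≤ Q.height + ringKrullDim (MvPolynomial (Fin d) k ⧸ Q))
    {S : Type*} [CommRing S] [IsDomain S] [Algebra k S] [Algebra.FiniteType k S]
    (hd : ringKrullDim S = d) (Q : Ideal S) [Q.IsPrime] :
    (d : WithBot ℕ∞) ≤ Q.height + ringKrullDim (S ⧸ Q) := by
  obtain ⟨s, g, hg, hfin⟩ := exists_finite_inj_algHom_of_fg k S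
  algebraize [g.toRingHom]
  have : Module.Finite (MvPolynomial (Fin s) k) S := hfin
  have : FaithfulSMul (MvPolynomial (Fin s) k) S :=
    (faithfulSMul_iff_algebraMap_injective _ _).mpr hg
  obtain rfl : s = d := by
    rw [ringKrullDim_eq_of_isIntegral (MvPolynomial (Fin s) k),
      MvPolynomial.ringKrullDim_fin] at hd
    exact_mod_cast hd
  have : IsNoetherianRing S := Algebra.FiniteType.isNoetherianRing k S
  have := Algebra.HasGoingDown.of_isIntegrallyClosed (MvPolynomial (Fin s) k) S
  have h4 := Ideal.height_le_of_liesOver_of_hasGoingDown (Q.under (MvPolynomial (Fin s) k)) Q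
  have h5 := h (Q.under _) inferInstance
  rw [← ringKrullDim_eq_of_isIntegral (MvPolynomial (Fin s) k ⧸ Q.under _) (S ⧸ Q)] at h5
  exact h5.trans (add_le_add_left (WithBot.coe_le_coe.mpr h4) _)

/-- Induction on the number of variables. A non-zero prime contains a prime element; dividing by it
leaves an affine domain of dimension `d`, to which the formula for `d` variables transfers by
Noether normalization. -/
theorem natCast_le_height_add_ringKrullDim_quotient {k : Type*} [Field k] [CharZero k] (d : ℕ)
    (Q : Ideal (MvPolynomial (Fin d) k)) [Q.IsPrime] :
    (d : WithBot ℕ∞) ≤ Q.height + ringKrullDim (MvPolynomial (Fin d) k ⧸ Q) := by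
  induction d with
  | zero =>
    have : 0 ≤ ringKrullDim (MvPolynomial (Fin 0) k ⧸ Q) := ringKrullDim_nonneg_of_nontrivial
    exact add_nonneg (by simp) this
  | succ d ih =>
    by_cases hQ : Q = ⊥
    · subst hQ
      rw [ringKrullDim_eq_of_ringEquiv (RingEquiv.quotientBot _), MvPolynomial.ringKrullDim_fin]
      simp
    obtain ⟨p, hpQ, hp⟩ := Ideal.IsPrime.exists_mem_prime_of_ne_bot inferInstance hQ
    let I : Ideal (MvPolynomial (Fin (d + 1)) k) := Ideal.span {p}
    have hIQ : I ≤ Q := (Ideal.span_singleton_le_iff_mem Q).mpr hpQ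
    have hI : I ≠ ⊥ := by simpa [I, Ideal.span_singleton_eq_bot] using hp.ne_zero
    have hIp : I.IsPrime := (Ideal.span_singleton_prime hp.ne_zero).mpr hp
    obtain ⟨m, hm, hQm⟩ := Ideal.exists_le_maximal Q Ideal.IsPrime.ne_top'
    have h1 : ((d + 1 : ℕ) : WithBot ℕ∞) ≤ ringKrullDim (_ ⧸ I) + 1 := by
      have := Ideal.height_le_ringKrullDim_quotient_add_one (hQm hpQ)
      rwa [MvPolynomial.height_of_isMaximal (d + 1) m] at this
    have h2 : ringKrullDim (_ ⧸ I) + 1 ≤ ((d + 1 : ℕ) : WithBot ℕ∞) :=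
      MvPolynomial.ringKrullDim_fin k (d + 1) ▸
        ringKrullDim_quotient_succ_le_of_nonZeroDivisor (mem_nonZeroDivisors_of_ne_zero hp.ne_zero)
    have hd : ringKrullDim (_ ⧸ I) = d := by
      have h3 := le_antisymm h2 h1
      push_cast at h3
      exact ENat.WithBot.add_one_cancel.mp h3
    let Q₁ : Ideal (_ ⧸ I) := Q.map (Ideal.Quotient.mk I)
    have : Q₁.IsPrime := Ideal.isPrime_map_quotientMk_of_isPrime hIQ
    have hcomap : Q₁.comap (Ideal.Quotient.mk I) = Q := by
      rw [Ideal.comap_map_of_surjective _ Ideal.Quotient.mk_surjective, ← RingHom.ker_eq_comap_bot,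
        Ideal.mk_ker, sup_eq_left.mpr hIQ]
    have h3 := Ideal.height_add_one_le_height_comap_quotientMk hI Q₁
    rw [hcomap] at h3
    have h5 := ringKrullDim_le_height_add_of_mvPolynomial d (fun Q _ => ih Q) hd Q₁
    rw [ringKrullDim_eq_of_ringEquiv (DoubleQuot.quotQuotEquivQuotOfLE hIQ)] at h5
    calc ((d + 1 : ℕ) : WithBot ℕ∞) = (d : WithBot ℕ∞) + 1 := by push_cast; rfl
      _ ≤ Q₁.height + ringKrullDim (_ ⧸ Q) + 1 := by gcongr
      _ = ((Q₁.height + 1 : ℕ∞) : WithBot ℕ∞) + ringKrullDim (_ ⧸ Q) := by push_cast; ring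
      _ ≤ _ := by gcongr; exact WithBot.coe_le_coe.mpr h3

/-! ### Chevalley's theorem, rational points, and derivations in characteristic zero. -/

/-- A dominant morphism of affine varieties: the image of a non-empty basic open set contains a
non-empty basic open set. -/
theorem exists_ne_zero_forall_prime_exists_liesOver {R S : Type*} [CommRing R] [IsDomain R]
    [CommRing S] [IsDomain S] [Algebra R S] [FaithfulSMul R S] [Algebra.FinitePresentation R S]
    {s : S} (hs : s ≠ 0) :
    ∃ h : R, h ≠ 0 ∧ ∀ p : Ideal R, p.IsPrime → h ∉ p →
      ∃ q : Ideal S, q.IsPrime ∧ s ∉ q ∧ q.under R = p := by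
  have hc := PrimeSpectrum.isConstructible_comap_image
    (RingHom.finitePresentation_algebraMap.mpr ‹Algebra.FinitePresentation R S›)
    (PrimeSpectrum.isConstructible_basicOpen (f := s))
  obtain ⟨T, hT⟩ := PrimeSpectrum.exists_constructibleSetData_iff.mpr hc
  have hbot : (⊥ : PrimeSpectrum R) ∈ PrimeSpectrum.comap (algebraMap R S) ''
      (PrimeSpectrum.basicOpen s : Set (PrimeSpectrum S)) := by
    refine ⟨⊥, by simpa using hs, PrimeSpectrum.ext ?_⟩
    exact Ideal.comap_bot_of_injective _ (FaithfulSMul.algebraMap_injective R S)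
  rw [← hT] at hbot
  simp only [PrimeSpectrum.ConstructibleSetData.toSet, Set.mem_iUnion] at hbot
  obtain ⟨C, hC, hg, hf⟩ := hbot
  -- The generic point lies in one locally closed piece `V(g) \ V(f)` of the image. Hence `f ≠ 0`
  -- and all of `g` is zero, so this piece is the basic open set of `f`.
  refine ⟨C.f, fun h0 => hf (by simp [h0]), fun p hp hfp => ?_⟩
  have hg0 : ∀ x ∈ Set.range C.g, x = 0 := fun x hx => by simpa using hg hx
  have hp' : (⟨p, hp⟩ : PrimeSpectrum R) ∈ PrimeSpectrum.comap (algebraMap R S) ''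
      (PrimeSpectrum.basicOpen s : Set (PrimeSpectrum S)) := by
    rw [← hT]
    simp only [PrimeSpectrum.ConstructibleSetData.toSet, Set.mem_iUnion]
    exact ⟨C, hC, fun x hx => by rw [hg0 x hx]; exact p.zero_mem, fun h => hfp (h rfl)⟩
  obtain ⟨q, hq, hqp⟩ := hp'
  exact ⟨q.asIdeal, q.2, hq, congrArg PrimeSpectrum.asIdeal hqp⟩

/-- Nullstellensatz: an element of a reduced affine algebra over an algebraically closed field is
determined by its values at the rational points. -/
theorem exists_algHom_apply_ne_zero {k B : Type*} [Field k] [IsAlgClosed k] [CommRing B]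
    [Algebra k B] [Algebra.FiniteType k B] [IsReduced B] {h : B} (hh : h ≠ 0) :
    ∃ φ : B →ₐ[k] k, φ h ≠ 0 := by
  have hB : IsJacobsonRing B := isJacobsonRing_of_finiteType (A := k)
  have h0 : h ∉ (⊥ : Ideal B).jacobson := by
    rw [← Ideal.radical_eq_jacobson]
    exact fun h1 => hh (by simpa using (IsReduced.eq_zero h h1))
  simp only [Ideal.jacobson, Ideal.mem_sInf, Set.mem_ofPred_eq, not_forall] at h0
  obtain ⟨M, ⟨-, hM⟩, hhM⟩ := h0
  let := Ideal.Quotient.field M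
  have : Algebra.IsIntegral k (B ⧸ M) := by
    have := finite_of_finite_type_of_isJacobsonRing k (B ⧸ M)
    infer_instance
  let ψ : (B ⧸ M) →ₐ[k] k := IsAlgClosed.lift
  refine ⟨ψ.comp (Ideal.Quotient.mkₐ k M), fun h1 => hhM ?_⟩
  exact Ideal.Quotient.eq_zero_iff_mem.mp ((map_eq_zero ψ).mp h1)

/-- Derivations extend along formally étale algebras. -/
theorem Derivation.exists_extend_of_formallyEtale {k S K : Type*} [CommRing k] [CommRing S]
    [CommRing K] [Algebra k S] [Algebra k K] [Algebra S K] [IsScalarTower k S K]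
    [Algebra.FormallyEtale S K] (d : Derivation k S S) :
    ∃ D : Derivation k K K, ∀ s, D (algebraMap S K s) = algebraMap S K (d s) := by
  let L : K ⊗[S] Ω[S⁄k] →ₗ[K] K :=
    (TensorProduct.AlgebraTensorModule.rid S K K).toLinearMap ∘ₗ
      d.liftKaehlerDifferential.baseChange K
  let M : Ω[K⁄k] →ₗ[K] K :=
    L ∘ₗ (KaehlerDifferential.tensorKaehlerEquivOfFormallyEtale k S K).symm.toLinearMap
  refine ⟨M.compDer (KaehlerDifferential.D k K), fun s => ?_⟩
  have : (M.compDer (KaehlerDifferential.D k K)) (algebraMap S K s) =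
      L (1 ⊗ₜ KaehlerDifferential.D k S s) := by
    rw [← KaehlerDifferential.tensorKaehlerEquivOfFormallyEtale_symm_D_algebraMap k S K]
    rfl
  rw [this]
  simp [L, Algebra.smul_def]

/-- An algebraically independent family in a field of characteristic zero has a dual family of
derivations. -/
theorem AlgebraicIndependent.exists_dual_derivation {k K ι : Type*} [Field k] [CharZero k] [Field K]
    [Algebra k K] [DecidableEq ι] {b : ι → K} (hb : AlgebraicIndependent k b) (j : ι) :
    ∃ D : Derivation k K K, ∀ i, D (b i) = if i = j then 1 else 0 := by
  classical
  -- Over the polynomial ring on a transcendence basis, `K` is formally étale in characteristic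
  -- zero, so the partial derivative with respect to `b j` extends to `K`.
  obtain ⟨s, hsb, hs⟩ := exists_isTranscendenceBasis_superset hb.coe_range
  let S := MvPolynomial s k
  let : Algebra S K := (MvPolynomial.aeval (R := k) ((↑) : s → K)).toRingHom.toAlgebra
  have hmap : ∀ p : S, algebraMap S K p = MvPolynomial.aeval ((↑) : s → K) p := fun _ => rfl
  have : IsScalarTower k S K :=
    .of_algebraMap_eq fun c => ((MvPolynomial.aeval (R := k) ((↑) : s → K)).commutes c).symm
  have : FaithfulSMul S K := (faithfulSMul_iff_algebraMap_injective _ _).mpr hs.1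
  let F := FractionRing S
  let := FractionRing.liftAlgebra S K
  have : IsScalarTower k F K := .of_algebraMap_eq fun c => by
    rw [IsScalarTower.algebraMap_apply k S K, IsScalarTower.algebraMap_apply k S F,
      ← IsScalarTower.algebraMap_apply S F K]
  have : Algebra.IsAlgebraic S K := by
    have := hs.isAlgebraic
    refine Algebra.IsAlgebraic.of_ringHom_of_comp_eq
      (S := Algebra.adjoin k (Set.range ((↑) : s → K)))
      hs.1.aevalEquiv (RingHom.id K) hs.1.aevalEquiv.surjective Function.injective_id ?_
    ext x
    · simp [hmap]
    · simp [hmap]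
  have : Algebra.IsAlgebraic F K :=
    IsFractionRing.comap_isAlgebraic_iff.mp ‹Algebra.IsAlgebraic S K›
  have : CharZero F := charZero_of_injective_algebraMap (algebraMap k F).injective
  have : Algebra.FormallyEtale F K := .of_isSeparable F K
  have : Algebra.FormallyEtale S F := .of_isLocalization (nonZeroDivisors S)
  have : Algebra.FormallyEtale S K := .comp S F K
  let v : ι → s := fun i => ⟨b i, hsb ⟨i, rfl⟩⟩
  obtain ⟨D, hD⟩ := Derivation.exists_extend_of_formallyEtale (K := K)
    (MvPolynomial.mkDerivation k (Pi.single (v j) (1 : S)))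
  refine ⟨D, fun i => ?_⟩
  have hi : b i = algebraMap S K (MvPolynomial.X (v i)) := by rw [hmap, MvPolynomial.aeval_X]
  rw [hi, hD, MvPolynomial.mkDerivation_X, Pi.single_apply]
  have hv : v i = v j ↔ i = j := by
    rw [Subtype.ext_iff]
    exact hb.injective.eq_iff
  simp only [hv]
  split_ifs <;> simp

/-! ### Polynomial functions and dimensions of subsets of `V`. -/

theorem ringKrullDim_quotient_inf_le {R : Type*} [CommRing R] (I J : Ideal R) :
    ringKrullDim (R ⧸ I ⊓ J) ≤ max (ringKrullDim (R ⧸ I)) (ringKrullDim (R ⧸ J)) := by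
  simp only [ringKrullDim_quotient]
  refine iSup_le fun l => ?_
  have key : ∀ K : Ideal R, K ≤ l.head.1.asIdeal →
      (l.length : WithBot ℕ∞) ≤ Order.krullDim (PrimeSpectrum.zeroLocus (K : Set R)) := by
    intro K hK
    let l' : LTSeries (PrimeSpectrum.zeroLocus (K : Set R)) :=
      { length := l.length
        toFun := fun i => ⟨(l i).1, hK.trans (l.head_le i)⟩
        step := fun i => l.step i }
    exact Order.LTSeries.length_le_krullDim l'
  have h : I ⊓ J ≤ l.head.1.asIdeal := l.head.2
  rcases (Ideal.IsPrime.inf_le l.head.1.2).mp h with h | h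
  · exact (key I h).trans (le_max_left _ _)
  · exact (key J h).trans (le_max_right _ _)

namespace AlgRep

section Poly

variable {k V : Type*} [Field k] [AddCommGroup V] [Module k V]

theorem vanishing_anti {S T : Set V} (h : S ⊆ T) : vanishing k T ≤ vanishing k S :=
  fun _ hp v hv => hp v (h hv)

theorem zdim_mono {S T : Set V} (h : S ⊆ T) : zdim k S ≤ zdim k T :=
  ringKrullDim_le_of_surjective (Ideal.Quotient.factor (vanishing_anti h))
    (Ideal.Quotient.factor_surjective _)

theorem vanishing_union (S T : Set V) : vanishing k (S ∪ T) = vanishing k S ⊓ vanishing k T := by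
  ext p
  exact ⟨fun h => ⟨fun v hv => h v (.inl hv), fun v hv => h v (.inr hv)⟩,
    fun h v hv => hv.elim (h.1 v) (h.2 v)⟩

theorem zdim_empty : zdim k (∅ : Set V) = ⊥ := by
  have : vanishing k (∅ : Set V) = ⊤ := (Ideal.eq_top_iff_one _).mpr fun v hv => hv.elim
  rw [zdim, this]
  exact ringKrullDim_eq_bot_of_subsingleton

theorem zdim_union_le (S T : Set V) : zdim k (S ∪ T) ≤ max (zdim k S) (zdim k T) := by
  rw [zdim, vanishing_union]
  exact ringKrullDim_quotient_inf_le _ _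

/-- Codimension bounds are carried as inequalities of sums, so that the empty set, of dimension `⊥`,
satisfies them for free. -/
theorem zdim_sUnion_add_le {C : Set (Set V)} (hC : C.Finite) {c D : WithBot ℕ∞}
    (h : ∀ S ∈ C, zdim k S + c ≤ D) : zdim k (⋃₀ C) + c ≤ D := by
  induction C, hC using Set.Finite.induction_on with
  | empty => rw [Set.sUnion_empty, zdim_empty, WithBot.bot_add]; exact bot_le
  | @insert S T _ _ ih =>
    rw [Set.sUnion_insert]
    refine (add_le_add_left (zdim_union_le _ _) c).trans ?_
    rcases max_choice (zdim k S) (zdim k (⋃₀ T)) with h' | h' <;> rw [h']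
    · exact h _ (.inl rfl)
    · exact ih fun S hS => h S (.inr hS)

variable {N : ℕ} (b : Module.Basis (Fin N) k V)

/-- A polynomial in the coordinates with respect to a basis, as a polynomial function. -/
def polyHom : MvPolynomial (Fin N) k →ₐ[k] PolyFun k V :=
  MvPolynomial.aeval fun i => ⟨fun v => b.coord i v, Algebra.subset_adjoin ⟨b.coord i, rfl⟩⟩

theorem polyHom_apply (p : MvPolynomial (Fin N) k) (v : V) :
    (polyHom b p : V → k) v = MvPolynomial.eval (fun i => b.repr v i) p := by
  let evalAt : PolyFun k V →ₐ[k] k := (Pi.evalAlgHom k (fun _ : V => k) v).comp (PolyFun k V).val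
  have : evalAt.comp (polyHom b) = MvPolynomial.aeval fun i => b.repr v i := by
    ext i
    simp [polyHom, evalAt]
  exact DFunLike.congr_fun this p

theorem polyHom_apply_equivFun_symm (p : MvPolynomial (Fin N) k) (x : Fin N → k) :
    (polyHom b p : V → k) (b.equivFun.symm x) = MvPolynomial.eval x p := by
  rw [polyHom_apply]
  exact congrArg (MvPolynomial.eval · p) (b.equivFun.apply_symm_apply x)

theorem polyHom_injective [Infinite k] : Function.Injective (polyHom b) := by
  intro p q h
  refine MvPolynomial.funext fun x => ?_
  have := congrArg (fun f : PolyFun k V => (f : V → k) (b.equivFun.symm x)) h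
  simpa only [polyHom_apply_equivFun_symm] using this

theorem polyHom_surjective : Function.Surjective (polyHom b) := by
  rintro ⟨f, hf⟩
  have : PolyFun k V ≤ ((PolyFun k V).val.comp (polyHom b)).range := by
    refine Algebra.adjoin_le ?_
    rintro _ ⟨l, rfl⟩
    refine ⟨∑ i, MvPolynomial.C (l (b i)) * MvPolynomial.X i, ?_⟩
    ext v
    have h1 : l v = ∑ i, b.repr v i * l (b i) := by
      conv_lhs => rw [← b.sum_repr v]
      simp only [map_sum, map_smul, smul_eq_mul]
    change (polyHom b _ : V → k) v = l v
    rw [polyHom_apply, h1]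
    simp [mul_comm]
  obtain ⟨p, hp⟩ := this hf
  exact ⟨p, Subtype.ext hp⟩

/-- The algebra of polynomial functions is a polynomial algebra in the coordinates. -/
def polyEquiv [Infinite k] : MvPolynomial (Fin N) k ≃ₐ[k] PolyFun k V :=
  AlgEquiv.ofBijective (polyHom b) ⟨polyHom_injective b, polyHom_surjective b⟩

section

variable [FiniteDimensional k V]

instance : Algebra.FiniteType k (PolyFun k V) :=
  .of_surjective (polyHom (Module.finBasis k V)) (polyHom_surjective _)

instance : IsNoetherianRing (PolyFun k V) := Algebra.FiniteType.isNoetherianRing k _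

instance [Infinite k] : IsDomain (PolyFun k V) :=
  (polyEquiv (Module.finBasis k V)).toMulEquiv.symm.isDomain _

/-- The Nullstellensatz for a prime, transported along `polyEquiv`. -/
theorem vanishing_setOf_eq [IsAlgClosed k] (Q : Ideal (PolyFun k V)) [Q.IsPrime] :
    vanishing k {v : V | ∀ p ∈ Q, (p : V → k) v = 0} = Q := by
  have : Infinite k := IsAlgClosed.instInfinite
  refine le_antisymm (fun p hp => ?_) fun p hp v hv => hv p hp
  let b := Module.finBasis k V
  let e := polyEquiv b
  let Q' := Q.comap e
  have hQ' := MvPolynomial.IsPrime.vanishingIdeal_zeroLocus (K := k) Q'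
  have h : e.symm p ∈ Q' := by
    rw [← hQ']
    intro x hx
    have h1 := hp (b.equivFun.symm x) fun q hq => by
      have h2 := hx (e.symm q) (by simpa [Q'] using hq)
      have h3 := polyHom_apply_equivFun_symm b (e.symm q) x
      rw [← e.apply_symm_apply q]
      exact h3.trans h2
    rw [← e.apply_symm_apply p] at h1
    exact (polyHom_apply_equivFun_symm b (e.symm p) x).symm.trans h1
  simpa [Q'] using h

theorem exists_apply_ne_zero [IsAlgClosed k] (Q : Ideal (PolyFun k V)) [Q.IsPrime] {s : PolyFun k V}
    (hs : s ∉ Q) : ∃ v : V, (∀ p ∈ Q, (p : V → k) v = 0) ∧ (s : V → k) v ≠ 0 := by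
  by_contra! h
  exact hs ((vanishing_setOf_eq Q).le fun v hv => h v hv)

theorem finrank_le_height_add_ringKrullDim [IsAlgClosed k] [CharZero k]
    (Q : Ideal (PolyFun k V)) [Q.IsPrime] :
    (Module.finrank k V : WithBot ℕ∞) ≤ Q.height + ringKrullDim (PolyFun k V ⧸ Q) := by
  let e := polyEquiv (Module.finBasis k V)
  have h := natCast_le_height_add_ringKrullDim_quotient _ (Q.comap e)
  rwa [show (Q.comap e).height = Q.height from e.toRingEquiv.height_comap Q,
    ringKrullDim_eq_of_ringEquiv (S := PolyFun k V ⧸ Q)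
      (Ideal.quotientEquiv (Q.comap e) Q e.toRingEquiv
      (Ideal.map_comap_of_surjective e.toRingEquiv e.surjective Q).symm)] at h

theorem zdim_le_finrank [Infinite k] (S : Set V) : zdim k S ≤ Module.finrank k V := by
  refine (ringKrullDim_quotient_le _).trans ?_
  rw [← ringKrullDim_eq_of_ringEquiv (polyEquiv (Module.finBasis k V)).toRingEquiv,
    MvPolynomial.ringKrullDim_fin]

end

end Poly

end AlgRep

/-! ### Tangent vectors and left invariant vector fields on `G`. -/

/-- The chain rule for derivations of a polynomial algebra along an evaluation. -/
theorem MvPolynomial.apply_eq_sum_pderiv_of_leibniz {k K σ : Type*} [CommRing k] [CommRing K]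
    [Algebra k K] [Fintype σ] (φ : MvPolynomial σ k →ₐ[k] K) (D : MvPolynomial σ k →ₗ[k] K)
    (hD : ∀ p q, D (p * q) = φ p * D q + D p * φ q) (p : MvPolynomial σ k) :
    D p = ∑ s, φ (MvPolynomial.pderiv s p) * D (MvPolynomial.X s) := by
  classical
  have h1 : D 1 = 0 := by simpa using hD 1 1
  induction p using MvPolynomial.induction_on with
  | C c =>
    have : (MvPolynomial.C c : MvPolynomial σ k) = c • 1 := by
      rw [MvPolynomial.smul_eq_C_mul, mul_one]
    simp [this, h1]
  | add p q hp hq => simp only [map_add, hp, hq, add_mul, Finset.sum_add_distrib]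
  | mul_X p i hp =>
    rw [hD, hp]
    simp only [Derivation.leibniz, smul_eq_mul, map_add, map_mul, MvPolynomial.pderiv_X,
      Pi.single_apply, add_mul, Finset.sum_add_distrib, Finset.sum_mul]
    congr 1
    · simp only [apply_ite, map_one, map_zero, mul_one, mul_zero, ite_mul, zero_mul]
      simp
    · exact Finset.sum_congr rfl fun s _ => by ring

namespace AlgRep

section Conv

variable {k A K : Type*} [Field k] [CommRing A] [HopfAlgebra k A] [CommRing K] [Algebra k K]

open WithConv

/-- Translation by a `K`-valued point carries tangent vectors at `φ` to tangent vectors at `f * φ`.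
It serves both to produce left invariant fields and to move a tangent vector at a generic point back
to the identity. -/
theorem convMul_leibniz (f : A →ₐ[k] K) (φ D : A →ₗ[k] K)
    (h : ∀ a b : A, D (a * b) = φ a * D b + D a * φ b) (a b : A) :
    (toConv f.toLinearMap * toConv D).ofConv (a * b) =
      (toConv f.toLinearMap * toConv φ).ofConv a * (toConv f.toLinearMap * toConv D).ofConv b
      + (toConv f.toLinearMap * toConv D).ofConv a *
        (toConv f.toLinearMap * toConv φ).ofConv b := by
  have key : ∀ T U : A ⊗[k] A,
      LinearMap.mul' k K (TensorProduct.map f.toLinearMap D (T * U)) =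
        LinearMap.mul' k K (TensorProduct.map f.toLinearMap φ T) *
          LinearMap.mul' k K (TensorProduct.map f.toLinearMap D U) +
        LinearMap.mul' k K (TensorProduct.map f.toLinearMap D T) *
          LinearMap.mul' k K (TensorProduct.map f.toLinearMap φ U) := by
    intro T U
    induction T with
    | zero => simp
    | add T₁ T₂ h₁ h₂ => simp only [add_mul, map_add, h₁, h₂]; ring
    | tmul a₁ a₂ =>
      induction U with
      | zero => simp
      | add U₁ U₂ h₁ h₂ => simp only [mul_add, map_add, h₁, h₂]; ring
      | tmul b₁ b₂ =>
        simp only [Algebra.TensorProduct.tmul_mul_tmul, TensorProduct.map_tmul,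
          LinearMap.mul'_apply, h, AlgHom.toLinearMap_apply, map_mul]
        ring
  have := key (Coalgebra.comul (R := k) a) (Coalgebra.comul (R := k) b)
  rw [← Bialgebra.comul_mul] at this
  exact this

/-- The left invariant vector field on `G` with value `x` at the identity, as an operator on
`k[G]`. -/
def leftInvariant (x : Module.Dual k A) : A →ₗ[k] A :=
  (toConv (LinearMap.id : A →ₗ[k] A) * toConv (Algebra.linearMap k A ∘ₗ x)).ofConv

theorem algHom_leftInvariant (φ : A →ₐ[k] K) (x : Module.Dual k A) (a : A) :
    φ (leftInvariant x a) =
      (toConv φ.toLinearMap * toConv (Algebra.linearMap k K ∘ₗ x)).ofConv a := by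
  have h := LinearMap.algHom_comp_convMul_distrib φ (toConv (LinearMap.id : A →ₗ[k] A))
    (toConv (Algebra.linearMap k A ∘ₗ x))
  have h2 : φ.toLinearMap ∘ₗ (Algebra.linearMap k A ∘ₗ x) = Algebra.linearMap k K ∘ₗ x := by
    ext a; simp
  simp only [LinearMap.comp_id, h2] at h
  exact LinearMap.congr_fun h a

theorem ev_leftInvariant (g : Points k A) (x : Module.Dual k A) (a : A) :
    g.ofConv (leftInvariant x a) = conv (ev g) x a :=
  algHom_leftInvariant g.ofConv x a

/-- A `K`-valued tangent vector at the identity is a `K`-linear combination of a basis of the Lie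
algebra. -/
theorem exists_eq_sum_lieAlg {n : ℕ} (e : Module.Basis (Fin n) k (lieAlg k A)) (y : A →ₗ[k] K)
    (hy : ∀ a b : A, y (a * b) = algebraMap k K (Coalgebra.counit (R := k) a) * y b +
      y a * algebraMap k K (Coalgebra.counit (R := k) b)) :
    ∃ c : Fin n → K, ∀ a, y a = ∑ i, c i * algebraMap k K ((e i : Module.Dual k A) a) := by
  let E : A →ₗ[k] Fin n → k := LinearMap.pi fun i => (e i : Module.Dual k A)
  -- For every `k`-linear `l : K → k` the functional `l ∘ y` belongs to the Lie algebra. An element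
  -- killed by the whole Lie algebra is therefore killed by `y`, and `y` factors through `E`.
  have hker : LinearMap.ker E ≤ LinearMap.ker y := by
    intro a ha
    have ha' : ∀ x : lieAlg k A, (x : Module.Dual k A) a = 0 := fun x => by
      have h1 : ∀ i, (e i : Module.Dual k A) a = 0 := fun i => congrFun ha i
      rw [← e.sum_repr x, Submodule.coe_sum, LinearMap.sum_apply]
      refine Finset.sum_eq_zero fun i _ => ?_
      change e.repr x i • (e i : Module.Dual k A) a = 0
      rw [h1, smul_zero]
    refine (Module.forall_dual_apply_eq_zero_iff k (y a)).mp fun l => ?_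
    refine ha' ⟨l ∘ₗ y, fun a b => ?_⟩
    simp only [LinearMap.comp_apply, hy, map_add, ← Algebra.smul_def, map_smul, smul_eq_mul,
      mul_comm (y a)]
    ring
  obtain ⟨L, hL⟩ := ((LinearMap.ker E).liftQ E le_rfl).exists_leftInverse_of_injective
    (Submodule.ker_liftQ_eq_bot' _ _ rfl)
  let h : (Fin n → k) →ₗ[k] K := (LinearMap.ker E).liftQ y hker ∘ₗ L
  have hh : ∀ a, h (E a) = y a := fun a => by
    have := LinearMap.congr_fun hL ((LinearMap.ker E).mkQ a)
    simp only [LinearMap.comp_apply, Submodule.mkQ_apply, Submodule.liftQ_apply,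
      LinearMap.id_apply] at this
    simp [h, this]
  refine ⟨fun i => h (Pi.single i 1), fun a => ?_⟩
  classical
  rw [← hh, pi_eq_sum_univ' (E a), map_sum]
  exact Finset.sum_congr rfl fun i _ => by
    rw [map_smul, Algebra.smul_def, mul_comm]
    congr 2

/-- The left invariant vector fields span all vector fields: a derivation of `k[G]` along a
homomorphism `k[G] → K` is a combination of left invariant ones. -/
theorem exists_eq_sum_leftInvariant {n : ℕ} (e : Module.Basis (Fin n) k (lieAlg k A))
    (φ : A →ₐ[k] K) (D : A →ₗ[k] K) (hD : ∀ a b, D (a * b) = φ a * D b + D a * φ b) :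
    ∃ c : Fin n → K, ∀ a, D a = ∑ i, c i * φ (leftInvariant (e i : Module.Dual k A) a) := by
  let ψ : A →ₐ[k] K := φ.comp (HopfAlgebra.antipodeAlgHom k A)
  have h1 : φ.toLinearMap ∘ₗ (1 : WithConv (A →ₗ[k] A)).ofConv =
      (1 : WithConv (A →ₗ[k] K)).ofConv := by
    ext a
    exact φ.commutes _
  have h2 : toConv ψ.toLinearMap * toConv φ.toLinearMap = 1 := by
    have := LinearMap.algHom_comp_convMul_distrib φ (toConv (HopfAlgebra.antipode k (A := A)))
      (toConv LinearMap.id)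
    rw [LinearMap.antipode_mul_id, h1] at this
    exact (WithConv.ext this).symm
  have h3 : toConv φ.toLinearMap * toConv ψ.toLinearMap = 1 := by
    have := LinearMap.algHom_comp_convMul_distrib φ (toConv LinearMap.id)
      (toConv (HopfAlgebra.antipode k (A := A)))
    rw [LinearMap.id_mul_antipode, h1] at this
    exact (WithConv.ext this).symm
  -- The inverse point `ψ` moves `D` to the identity, where it is expanded in the basis; convolution
  -- with `φ` moves the expansion back.
  let y : A →ₗ[k] K := (toConv ψ.toLinearMap * toConv D).ofConv
  obtain ⟨c, hc⟩ := exists_eq_sum_lieAlg e y fun a b => by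
    have := convMul_leibniz ψ φ.toLinearMap D hD a b
    rw [h2] at this
    exact this
  have hDy : toConv D = toConv φ.toLinearMap * toConv y := by
    change toConv D = toConv φ.toLinearMap * (toConv ψ.toLinearMap * toConv D)
    rw [← mul_assoc, h3, one_mul]
  have hy : toConv y = ∑ i, c i • toConv (Algebra.linearMap k K ∘ₗ (e i : Module.Dual k A)) := by
    refine WithConv.ext (LinearMap.ext fun a => ?_)
    simp [hc]
  refine ⟨c, fun a => ?_⟩
  simp only [algHom_leftInvariant]
  change (toConv D).ofConv a = _
  rw [hDy, hy, Finset.mul_sum]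
  simp only [mul_smul_comm]
  simp

end Conv

end AlgRep

/-! ### The group action, orbits and the orbit map. -/

namespace AlgRep

open WithConv

variable {k A V : Type*} [Field k] [CommRing A] [HopfAlgebra k A] [AddCommGroup V] [Module k V]
  (ρ : RationalRep k A V)

theorem dualAct_conv (x y : Module.Dual k A) (v : V) :
    dualAct ρ (conv x y) v = dualAct ρ x (dualAct ρ y v) := by
  let m : A ⊗[k] A →ₗ[k] k := LinearMap.mul' k k ∘ₗ TensorProduct.map x y
  have key : ∀ T : V ⊗[k] A,
      TensorProduct.rid k V (m.lTensor V (TensorProduct.assoc k V A A (ρ.coact.rTensor A T))) =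
        dualAct ρ x (TensorProduct.rid k V (y.lTensor V T)) := by
    intro T
    induction T with
    | zero => simp
    | add T₁ T₂ h₁ h₂ => simp only [map_add, h₁, h₂]
    | tmul u a =>
      have h : ∀ S : V ⊗[k] A,
          TensorProduct.rid k V (m.lTensor V (TensorProduct.assoc k V A A (S ⊗ₜ a))) =
            y a • TensorProduct.rid k V (x.lTensor V S) := by
        intro S
        induction S with
        | zero => simp
        | add S₁ S₂ h₁ h₂ => simp only [TensorProduct.add_tmul, map_add, h₁, h₂, smul_add]
        | tmul u a' => simp [m, smul_smul, mul_comm]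
      simp only [LinearMap.rTensor_tmul, h, LinearMap.lTensor_tmul, TensorProduct.rid_tmul,
        map_smul]
      rfl
  have h := key (ρ.coact v)
  rw [ρ.coassoc, ← LinearMap.comp_apply, ← LinearMap.lTensor_comp] at h
  exact h

theorem act_one (v : V) : act ρ 1 v = v := ρ.counit_coact v

theorem act_mul (g h : Points k A) (v : V) : act ρ (g * h) v = act ρ g (act ρ h v) := by
  rw [act, act, act, ← dualAct_conv]
  congr 1

theorem act_inv_act (g : Points k A) (v : V) : act ρ g⁻¹ (act ρ g v) = v := by
  rw [← act_mul, inv_mul_cancel, act_one]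

theorem mem_orbit_self (v : V) : v ∈ orbit ρ v := ⟨1, act_one ρ v⟩

theorem orbit_act (g : Points k A) (v : V) : orbit ρ (act ρ g v) = orbit ρ v := by
  ext w
  constructor
  · rintro ⟨h, rfl⟩
    exact ⟨h * g, act_mul ρ h g v⟩
  · rintro ⟨h, rfl⟩
    refine ⟨h * g⁻¹, ?_⟩
    change act ρ _ _ = act ρ h v
    rw [act_mul, act_inv_act]

theorem quotientMap_act (g : Points k A) (v : V) :
    quotientMap ρ (act ρ g v) = quotientMap ρ v := by
  ext p
  exact p.2 g v

theorem orbit_subset_nullCone {v : V} (hv : v ∈ nullCone ρ) : orbit ρ v ⊆ nullCone ρ := by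
  rintro _ ⟨g, rfl⟩
  exact (quotientMap_act ρ g v).trans hv

section Equivariant

variable {m : ℕ} {F : Fin m → Mor k V (lieAlg k A)} (hF : ∀ j, IsEquivariant ρ (F j))

/-- The adjoint action as a linear map. -/
def adLinear (g : Points k A) : lieAlg k A →ₗ[k] lieAlg k A where
  toFun := Ad g
  map_add' x y := Subtype.ext <| congrArg ofConv <| by
    change (toConv (ev g) * (toConv (x : Module.Dual k A) + toConv (y : Module.Dual k A))) *
      toConv (ev g⁻¹) = _
    rw [mul_add, add_mul]
    rfl
  map_smul' c x := Subtype.ext <| congrArg ofConv <| by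
    change (toConv (ev g) * (c • toConv (x : Module.Dual k A))) * toConv (ev g⁻¹) = _
    rw [mul_smul_comm, smul_mul_assoc]
    rfl

include hF

/-- By equivariance the span at `g · v` is the image under `Ad g` of the span at `v`. -/
theorem spanDim_act_le (g : Points k A) (v : V) : spanDim F (act ρ g v) ≤ spanDim F v := by
  have h : Set.range (fun j => (F j : V → lieAlg k A) (act ρ g v)) =
      adLinear g '' Set.range fun j => (F j : V → lieAlg k A) v := by
    rw [← Set.range_comp]
    exact congrArg Set.range (funext fun j => hF j g v)
  rw [spanDim, h, ← Submodule.map_span]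
  have := FiniteDimensional.span_of_finite k
    (Set.finite_range fun j => (F j : V → lieAlg k A) v)
  exact Submodule.finrank_map_le _ _

theorem spanDim_act (g : Points k A) (v : V) : spanDim F (act ρ g v) = spanDim F v := by
  refine le_antisymm (spanDim_act_le ρ hF g v) ?_
  have := spanDim_act_le ρ hF g⁻¹ (act ρ g v)
  rwa [act_inv_act] at this

end Equivariant

section OrbitMap

/-- The matrix coefficient `g ↦ l (g · w)` as an element of `k[G]`. -/
def matrixCoeff (l : Module.Dual k V) (w : V) : A :=
  TensorProduct.lid k A (l.rTensor A (ρ.coact w))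

theorem apply_matrixCoeff (x : Module.Dual k A) (l : Module.Dual k V) (w : V) :
    x (matrixCoeff ρ l w) = l (dualAct ρ x w) := by
  have : ∀ T : V ⊗[k] A, x (TensorProduct.lid k A (l.rTensor A T)) =
      l (TensorProduct.rid k V (x.lTensor V T)) := by
    intro T
    induction T with
    | zero => simp
    | add T₁ T₂ h₁ h₂ => simp only [map_add, h₁, h₂]
    | tmul u a => simp [mul_comm]
  exact this _

variable {N : ℕ} (b : Module.Basis (Fin N) k V)

/-- The comorphism of the orbit map `g ↦ g · w`, in coordinates. -/
def orbitHom (w : V) : MvPolynomial (Fin N) k →ₐ[k] A :=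
  MvPolynomial.aeval fun s => matrixCoeff ρ (b.coord s) w

theorem ev_orbitHom (g : Points k A) (w : V) (p : MvPolynomial (Fin N) k) :
    g.ofConv (orbitHom ρ b w p) = (polyHom b p : V → k) (act ρ g w) := by
  rw [polyHom_apply]
  have : g.ofConv.comp (orbitHom ρ b w) = MvPolynomial.aeval fun i => b.repr (act ρ g w) i := by
    ext i
    have := apply_matrixCoeff ρ (ev g) (b.coord i) w
    simp only [orbitHom, AlgHom.comp_apply, MvPolynomial.aeval_X]
    exact this
  exact DFunLike.congr_fun this p

theorem leftInvariant_leibniz (x : lieAlg k A) (a a' : A) :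
    leftInvariant (x : Module.Dual k A) (a * a') =
      a * leftInvariant (x : Module.Dual k A) a' + leftInvariant (x : Module.Dual k A) a * a' := by
  have h := convMul_leibniz (AlgHom.id k A) (1 : WithConv (A →ₗ[k] A)).ofConv
    (Algebra.linearMap k A ∘ₗ (x : Module.Dual k A)) (fun a b => by
      simp only [LinearMap.comp_apply, x.2 a b, map_add, Algebra.linearMap_apply, map_mul]
      rfl) a a'
  have h1 : toConv (AlgHom.id k A).toLinearMap *
    toConv (1 : WithConv (A →ₗ[k] A)).ofConv = toConv LinearMap.id := mul_one _
  rw [h1] at h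
  exact h

/-- The derivative of a function along the orbit map. -/
theorem conv_ev_orbitHom (g : Points k A) (x : lieAlg k A) (w : V) (p : MvPolynomial (Fin N) k) :
    g.ofConv (leftInvariant (x : Module.Dual k A) (orbitHom ρ b w p)) =
      ∑ s, (polyHom b (MvPolynomial.pderiv s p) : V → k) (act ρ g w) *
        b.repr (act ρ g (lieAct ρ x w)) s := by
  let φ : MvPolynomial (Fin N) k →ₐ[k] k := g.ofConv.comp (orbitHom ρ b w)
  let D : MvPolynomial (Fin N) k →ₗ[k] k :=
    g.ofConv.toLinearMap ∘ₗ leftInvariant (x : Module.Dual k A) ∘ₗ (orbitHom ρ b w).toLinearMap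
  have h := MvPolynomial.apply_eq_sum_pderiv_of_leibniz φ D (fun p q => by
    simp [D, φ, leftInvariant_leibniz]) p
  refine h.trans (Finset.sum_congr rfl fun s _ => ?_)
  congr 1
  · exact ev_orbitHom ρ b g w _
  · change g.ofConv (leftInvariant (x : Module.Dual k A) (orbitHom ρ b w (MvPolynomial.X s))) = _
    rw [ev_leftInvariant, orbitHom, MvPolynomial.aeval_X, apply_matrixCoeff, dualAct_conv]
    rfl

end OrbitMap

end AlgRep

-- The Jacobian criterion and the dimension of an orbit.

universe u in
/-- Jacobian criterion, one direction: if the operators `δ i` span all derivations of `A` into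
fields, then the gradients of functions which are algebraically independent modulo a prime `P` are
linearly independent on a non-empty open subset of the zero set of `P`. -/
theorem exists_forall_linearIndependent_of_algebraicIndependent {k : Type*} {A : Type u} {n s : ℕ}
    [Field k] [CharZero k] [CommRing A] [Algebra k A] (δ : Fin n → A → A)
    (hδ : ∀ (K : Type u) [Field K] [Algebra k K] (φ : A →ₐ[k] K) (D : A →ₗ[k] K),
      (∀ a b, D (a * b) = φ a * D b + D a * φ b) →
        ∃ c : Fin n → K, ∀ a, D a = ∑ i, c i * φ (δ i a))
    (P : Ideal A) [P.IsPrime] (b : Fin s → A)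
    (hb : ∀ p : MvPolynomial (Fin s) k, MvPolynomial.aeval b p ∈ P → p = 0) :
    ∃ h ∉ P, ∀ ψ : A →ₐ[k] k, (∀ a ∈ P, ψ a = 0) → ψ h ≠ 0 →
      LinearIndependent k fun j : Fin s => fun i : Fin n => ψ (δ i (b j)) := by
  let K := FractionRing (A ⧸ P)
  let φ : A →ₐ[k] K := (IsScalarTower.toAlgHom k (A ⧸ P) K).comp (Ideal.Quotient.mkₐ k P)
  have hφ : ∀ a, φ a = 0 ↔ a ∈ P := fun a => by
    rw [← Ideal.Quotient.eq_zero_iff_mem,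
      ← map_eq_zero_iff (algebraMap (A ⧸ P) K) (IsFractionRing.injective _ _)]
    rfl
  have hind : AlgebraicIndependent k (φ ∘ b) := by
    refine (injective_iff_map_eq_zero _).mpr fun p hp => hb p ((hφ _).mp ?_)
    rw [← hp]
    exact DFunLike.congr_fun (MvPolynomial.comp_aeval b φ) p
  choose D hD using fun j => hind.exists_dual_derivation j
  choose c hc using fun j => hδ K φ ((D j).toLinearMap ∘ₗ φ.toLinearMap)
    (fun a a' => by simp [mul_comm (φ a')])
  -- Clearing denominators in the dual derivations yields a matrix `C` over `A` that inverts the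
  -- gradients modulo `P` up to the factor `h`; independence thus survives wherever `h` does not
  -- vanish.
  obtain ⟨⟨d, hd⟩, hd'⟩ := IsLocalization.exist_integer_multiples_of_finite
    (nonZeroDivisors (A ⧸ P)) fun x : Fin s × Fin n => c x.1 x.2
  choose c' hc' using hd'
  obtain ⟨h, rfl⟩ := Ideal.Quotient.mk_surjective d
  choose C hC using fun x => Ideal.Quotient.mk_surjective (c' x)
  have hφC : ∀ j i, φ (C (j, i)) = φ h * c j i := fun j i => by
    have := hc' (j, i)
    rw [← hC] at this
    exact this.trans (Algebra.smul_def _ _)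
  refine ⟨h, fun hP => nonZeroDivisors.ne_zero hd (Ideal.Quotient.eq_zero_iff_mem.mpr hP),
    fun ψ hψ hψh => ?_⟩
  have key : ∀ j j', ∑ i, ψ (C (j, i)) * ψ (δ i (b j')) = if j' = j then ψ h else 0 := by
    intro j j'
    have : (∑ i, C (j, i) * δ i (b j')) - (if j' = j then h else 0) ∈ P := by
      rw [← hφ, map_sub, map_sum, sub_eq_zero]
      simp only [map_mul, hφC, mul_assoc]
      rw [← Finset.mul_sum, ← hc]
      have := hD j j'
      simp only [Function.comp_apply] at this
      simp only [LinearMap.comp_apply, AlgHom.toLinearMap_apply, Derivation.coeFn_coe, this]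
      split_ifs <;> simp
    have := hψ _ this
    rw [map_sub, sub_eq_zero, map_sum] at this
    simp only [map_mul] at this
    rw [this]
    split_ifs <;> simp
  refine Fintype.linearIndependent_iff.mpr fun g hg j => ?_
  have h1 : ∑ i, ψ (C (j, i)) * (∑ j', g j' • fun i => ψ (δ i (b j'))) i = g j * ψ h := by
    simp only [Finset.sum_apply, Pi.smul_apply, smul_eq_mul, Finset.mul_sum]
    rw [Finset.sum_comm]
    simp only [mul_left_comm _ (g _), ← Finset.mul_sum, key]
    simp
  rw [hg] at h1
  simp only [Pi.zero_apply, mul_zero, Finset.sum_const_zero] at h1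
  exact (mul_eq_zero.mp h1.symm).resolve_right hψh

namespace AlgRep

open WithConv

variable {k A V : Type*} [Field k] [CommRing A] [HopfAlgebra k A] [AddCommGroup V] [Module k V]
  (ρ : RationalRep k A V)

/-- The tangent space `𝔤 · v` of the orbit at `v`. -/
def lieOrbit (v : V) : Submodule k V := LinearMap.range ((lieAct ρ).flip v)

theorem leftInvariant_algebraMap (x : lieAlg k A) (c : k) :
    leftInvariant (x : Module.Dual k A) (algebraMap k A c) = 0 := by
  have h1 : leftInvariant (x : Module.Dual k A) (1 : A) = 0 := by
    simpa using leftInvariant_leibniz x 1 1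
  rw [Algebra.algebraMap_eq_smul_one, map_smul, h1, smul_zero]

section

variable [IsAlgClosed k] [Algebra.FiniteType k A] [IsReduced A]

theorem eq_of_forall_points {a a' : A} (h : ∀ g : Points k A, g.ofConv a = g.ofConv a') :
    a = a' := by
  by_contra hne
  obtain ⟨φ, hφ⟩ := exists_algHom_apply_ne_zero (k := k) (sub_ne_zero.mpr hne)
  exact hφ (by rw [map_sub, sub_eq_zero]; exact h (toConv φ))

variable {N : ℕ} (b : Module.Basis (Fin N) k V)

/-- Identifies the coordinate ring of the orbit closure with the range of the comorphism.
Reducedness of `A` allows equality to be tested at points. -/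
theorem orbitHom_eq_zero_iff (w : V) (p : MvPolynomial (Fin N) k) :
    orbitHom ρ b w p = 0 ↔ polyHom b p ∈ vanishing k (orbit ρ w) := by
  constructor
  · rintro h _ ⟨g, rfl⟩
    exact (ev_orbitHom ρ b g w p).symm.trans (by rw [h, map_zero])
  · intro h
    refine eq_of_forall_points (k := k) fun g => ?_
    rw [ev_orbitHom, map_zero]
    exact h _ ⟨g, rfl⟩

variable [CharZero k]

include b in
-- The orbit closure carries `dim` many algebraically independent functions. Their pullbacks to `G`
-- have independent gradients at some point, and these gradients factor through the tangent space `𝔤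
-- · w`, which must therefore be large enough.
theorem zdim_orbit_le {n : ℕ} (e : Module.Basis (Fin n) k (lieAlg k A)) (w : V) :
    zdim k (orbit ρ w) ≤ Module.finrank k (lieOrbit ρ w) := by
  have : FiniteDimensional k V := b.finiteDimensional_of_finite
  let μ := orbitHom ρ b w
  let B := μ.range
  have : Nontrivial A := (1 : Points k A).ofConv.toRingHom.domain_nontrivial
  have : Algebra.FiniteType k B := .of_surjective μ.rangeRestrict μ.rangeRestrict_surjective
  have hdim : zdim k (orbit ρ w) = ringKrullDim B := by
    let F : PolyFun k V →ₐ[k] B := μ.rangeRestrict.comp (polyEquiv b).symm.toAlgHom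
    have hF : Function.Surjective F :=
      μ.rangeRestrict_surjective.comp (polyEquiv b).symm.surjective
    have hker : vanishing k (orbit ρ w) = RingHom.ker F := by
      ext p
      obtain ⟨p, rfl⟩ := (polyEquiv b).surjective p
      rw [RingHom.mem_ker]
      refine (orbitHom_eq_zero_iff ρ b w p).symm.trans ?_
      rw [show F (polyEquiv b p) = μ.rangeRestrict p from
        congrArg μ.rangeRestrict ((polyEquiv b).symm_apply_apply p)]
      exact ⟨fun h => Subtype.ext h, fun h => congrArg Subtype.val h⟩
    rw [zdim, hker]
    exact ringKrullDim_eq_of_ringEquiv (RingHom.quotientKerEquivOfSurjective (f := F.toRingHom) hF)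
  obtain ⟨s, g, hg, hfin⟩ := exists_finite_inj_algHom_of_fg k B
  have hs : ringKrullDim B ≤ s := by
    algebraize [g.toRingHom]
    have : Module.Finite (MvPolynomial (Fin s) k) B := hfin
    rw [← MvPolynomial.ringKrullDim_fin k s]
    exact ringKrullDim_le_of_isIntegral _ _
  choose p hp using fun j : Fin s => (g (MvPolynomial.X j)).2
  let ι : MvPolynomial (Fin s) k →ₐ[k] A := B.val.comp g
  have hι : ι = MvPolynomial.aeval fun j => μ (p j) := by
    ext j
    rw [MvPolynomial.aeval_X]
    exact (hp j).symm
  have hιinj : Function.Injective ι := Subtype.val_injective.comp hg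
  -- Passing to a prime of `A` with zero contraction keeps the functions algebraically independent
  -- and makes the quotient a domain.
  obtain ⟨P, hP, hPι⟩ := Ideal.exists_comap_eq_of_mem_minimalPrimes_of_injective
    (f := ι.toRingHom) hιinj ⊥ (by rw [IsDomain.minimalPrimes_eq_singleton_bot]; rfl)
  obtain ⟨h, hh, hψ⟩ := exists_forall_linearIndependent_of_algebraicIndependent
    (fun i => leftInvariant (e i : Module.Dual k A))
    (fun _ _ _ φ D hD => exists_eq_sum_leftInvariant e φ D hD) P (fun j => μ (p j)) (fun q hq => by
      rw [← hι] at hq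
      exact (hPι.le hq : q ∈ (⊥ : Ideal _)))
  obtain ⟨θ, hθ⟩ := exists_algHom_apply_ne_zero (k := k) (h := Ideal.Quotient.mk P h)
    fun h0 => hh (Ideal.Quotient.eq_zero_iff_mem.mp h0)
  have hli := hψ (θ.comp (Ideal.Quotient.mkₐ k P))
    (fun a ha => by simp [Ideal.Quotient.eq_zero_iff_mem.mpr ha]) hθ
  let x : Points k A := toConv (θ.comp (Ideal.Quotient.mkₐ k P))
  -- The differential of `p j` at `x · w`, pulled back along `x`; on `𝔤 · w` it records the
  -- derivatives of `μ (p j)` at `x`.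
  let l : Fin s → Module.Dual k V := fun j =>
    ∑ t, (polyHom b (MvPolynomial.pderiv t (p j)) : V → k) (act ρ x w) • (b.coord t ∘ₗ act ρ x)
  have hl : ∀ j (y : lieAlg k A), x.ofConv (leftInvariant (y : Module.Dual k A) (μ (p j))) =
      l j (lieAct ρ y w) := fun j y => by
    rw [conv_ev_orbitHom]
    simp [l]
  let L : Module.Dual k (lieOrbit ρ w) →ₗ[k] Fin n → k :=
    LinearMap.pi fun i => Module.Dual.eval k _ ⟨lieAct ρ (e i) w, ⟨e i, rfl⟩⟩
  have hli' : LinearIndependent k fun j => (l j).domRestrict (lieOrbit ρ w) := by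
    refine LinearIndependent.of_comp L ?_
    convert hli using 1
    ext j i
    exact (hl j (e i)).symm
  have := hli'.fintype_card_le_finrank
  rw [Subspace.dual_finrank_eq, Fintype.card_fin] at this
  rw [hdim]
  exact hs.trans (by exact_mod_cast this)

end

end AlgRep

theorem MvPolynomial.exists_forall_linearIndependent_pderiv {k : Type*} [Field k] [CharZero k]
    {N l : ℕ} {f : Fin l → MvPolynomial (Fin N) k} (hf : AlgebraicIndependent k f) :
    ∃ h : MvPolynomial (Fin N) k, h ≠ 0 ∧ ∀ x : Fin N → k, MvPolynomial.eval x h ≠ 0 →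
      LinearIndependent k fun j i => MvPolynomial.eval x (MvPolynomial.pderiv i (f j)) := by
  obtain ⟨h, hh, H⟩ := exists_forall_linearIndependent_of_algebraicIndependent
    (fun i => (MvPolynomial.pderiv i : MvPolynomial (Fin N) k → MvPolynomial (Fin N) k))
    (fun _ _ _ φ D hD => ⟨fun i => D (X i), fun p => by
      rw [apply_eq_sum_pderiv_of_leibniz φ D hD p]
      exact Finset.sum_congr rfl fun i _ => mul_comm _ _⟩) ⊥ f
    (fun p hp => (injective_iff_map_eq_zero _).mp hf p hp)
  exact ⟨h, hh, fun x hx => H (MvPolynomial.aeval x) (fun a ha => by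
    rw [(Ideal.mem_bot.mp ha), map_zero]) hx⟩

/-! ### Differentials of invariants and the dimension of the null-cone. -/

namespace AlgRep

variable {k A V : Type*} [Field k] [CommRing A] [HopfAlgebra k A] [AddCommGroup V] [Module k V]
  (ρ : RationalRep k A V)

/-- Evaluation of polynomial functions at a point. -/
def evalAt (v : V) : PolyFun k V →ₐ[k] k :=
  (Pi.evalAlgHom k (fun _ : V => k) v).comp (PolyFun k V).val

/-- A linear functional as a polynomial function. -/
def linearFun (L : Module.Dual k V) : PolyFun k V := ⟨L, Algebra.subset_adjoin ⟨L, rfl⟩⟩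

theorem exists_dual_family {E : Type*} [AddCommGroup E] [Module k E] {ι : Type*} [DecidableEq ι]
    {u : ι → E} (hu : LinearIndependent k u) :
    ∃ L : ι → Module.Dual k E, ∀ i j, L j (u i) = if i = j then 1 else 0 := by
  choose L hL using fun j => (((Module.Basis.span hu).coord j).exists_extend)
  refine ⟨L, fun i j => ?_⟩
  have h1 : u i = (Module.Basis.span hu i).1 := 
    (congrArg Subtype.val (Module.Basis.span_apply hu i)).symm
  rw [h1]
  refine (LinearMap.congr_fun (hL j) (Module.Basis.span hu i)).trans ?_
  rw [Module.Basis.coord_apply, Module.Basis.repr_self, Finsupp.single_apply]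

theorem linearIndependent_of_det_ne_zero {E : Type*} [AddCommGroup E] [Module k E] {r : ℕ}
    (u : Fin r → E) (L : Fin r → Module.Dual k E)
    (h : (Matrix.of fun i j => L j (u i)).det ≠ 0) : LinearIndependent k u :=
  .of_comp (LinearMap.pi L) (Matrix.linearIndependent_rows_of_det_ne_zero h)

/-- The dimension of `𝔤 · v` is lower semicontinuous. -/
theorem exists_forall_finrank_lieOrbit_le [FiniteDimensional k V] (w : V) :
    ∃ q : PolyFun k V, evalAt w q ≠ 0 ∧ ∀ v, evalAt v q ≠ 0 →
      Module.finrank k (lieOrbit ρ w) ≤ Module.finrank k (lieOrbit ρ v) := by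
  let β := Module.finBasis k (lieOrbit ρ w)
  choose x hx using fun i => (β i).2
  obtain ⟨L, hL⟩ := exists_dual_family
    (β.linearIndependent.map' (lieOrbit ρ w).subtype (Submodule.ker_subtype _))
  let M := Matrix.of fun i j => linearFun (L j ∘ₗ lieAct ρ (x i))
  have hM : ∀ v, evalAt v M.det = (Matrix.of fun i j => L j (lieAct ρ (x i) v)).det := fun v => by
    rw [AlgHom.map_det]
    rfl
  refine ⟨M.det, ?_, fun v hv => ?_⟩
  · have : (Matrix.of fun i j => L j (lieAct ρ (x i) w)) = 1 := by
      ext i j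
      have h1 : lieAct ρ (x i) w = β i := hx i
      rw [Matrix.of_apply, h1]
      exact hL i j
    rw [hM, this, Matrix.det_one]
    exact one_ne_zero
  · rw [hM] at hv
    have h1 := linearIndependent_of_det_ne_zero (fun i => lieAct ρ (x i) v) L hv
    have h2 : LinearIndependent k fun i => (⟨lieAct ρ (x i) v, x i, rfl⟩ : lieOrbit ρ v) :=
      .of_comp (lieOrbit ρ v).subtype h1
    simpa using h2.fintype_card_le_finrank

theorem zdim_add_le_of_forall_orbit {X : Set V} (hfin : (orbit ρ '' X).Finite)
    {c D : WithBot ℕ∞} (h : ∀ v ∈ X, zdim k (orbit ρ v) + c ≤ D) : zdim k X + c ≤ D := by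
  have hX : X ⊆ ⋃₀ (orbit ρ '' X) := fun v hv => ⟨_, ⟨v, hv, rfl⟩, mem_orbit_self ρ v⟩
  refine (add_le_add_left (zdim_mono hX) c).trans (zdim_sUnion_add_le hfin ?_)
  rintro _ ⟨v, hv, rfl⟩
  exact h v hv

variable [IsAlgClosed k] [Algebra.FiniteType k A] [IsReduced A]

/-- The differential of an invariant polynomial kills the tangent spaces of orbits. -/
theorem sum_pderiv_mul_repr_lieAct_eq_zero {N : ℕ} (b : Module.Basis (Fin N) k V)
    {p : MvPolynomial (Fin N) k} (hp : polyHom b p ∈ invariants ρ) (x : lieAlg k A) (v : V) :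
    ∑ s, (polyHom b (MvPolynomial.pderiv s p) : V → k) v * b.repr (lieAct ρ x v) s = 0 := by
  -- An invariant pulls back to a constant along the orbit map, and left invariant fields kill
  -- constants.
  have h1 : orbitHom ρ b v p = algebraMap k A ((polyHom b p : V → k) v) := by
    refine eq_of_forall_points (k := k) fun g => ?_
    rw [ev_orbitHom, hp g v, AlgHom.commutes]
    rfl
  have h2 := conv_ev_orbitHom ρ b 1 x v p
  rw [h1, leftInvariant_algebraMap, map_zero] at h2
  simpa only [act_one] using h2.symm

variable [CharZero k] [FiniteDimensional k V]

/-- At a generic `v` the `l` differentials are independent and lie in the annihilator of `𝔤 · v`.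
Lower semicontinuity carries the bound to an arbitrary `w`. -/
theorem finrank_lieOrbit_add_le {l : ℕ} {f : Fin l → invariants ρ} (hf : AlgebraicIndependent k f)
    (w : V) : Module.finrank k (lieOrbit ρ w) + l ≤ Module.finrank k V := by
  have : Infinite k := IsAlgClosed.instInfinite
  let b := Module.finBasis k V
  let g : Fin l → MvPolynomial (Fin (Module.finrank k V)) k := fun j => (polyEquiv b).symm (f j)
  have hgf : ∀ j, polyHom b (g j) = f j := fun j => (polyEquiv b).apply_symm_apply _
  have hg : AlgebraicIndependent k g :=
    hf.map' (f := (polyEquiv b).symm.toAlgHom.comp (invariants ρ).val)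
      ((polyEquiv b).symm.injective.comp Subtype.val_injective)
  obtain ⟨h, hh, H⟩ := MvPolynomial.exists_forall_linearIndependent_pderiv hg
  obtain ⟨q, hq, Hq⟩ := exists_forall_finrank_lieOrbit_le ρ w
  have hne : polyHom b h * q ≠ 0 :=
    mul_ne_zero ((map_ne_zero_iff _ (polyHom_injective b)).mpr hh) fun h0 => hq (by
      rw [h0, map_zero])
  obtain ⟨v, -, hv⟩ := exists_apply_ne_zero (k := k) (⊥ : Ideal (PolyFun k V))
    (s := polyHom b h * q) hne
  have hv' : evalAt v (polyHom b h) * evalAt v q ≠ 0 := by rwa [← map_mul]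
  have hind := H (fun i => b.repr v i) (by
    rw [← polyHom_apply]
    exact left_ne_zero_of_mul hv')
  refine (Nat.add_le_add_right (Hq v (right_ne_zero_of_mul hv')) l).trans ?_
  let T : (Fin (Module.finrank k V) → k) →ₗ[k] Module.Dual k V := (b.constr k).toLinearMap
  have hT : LinearIndependent k (T ∘ fun j i =>
      MvPolynomial.eval (fun i => b.repr v i) (MvPolynomial.pderiv i (g j))) :=
    hind.map' T (LinearEquiv.ker _)
  have hmem : ∀ j, (T fun i =>
      MvPolynomial.eval (fun i => b.repr v i) (MvPolynomial.pderiv i (g j))) ∈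
        (lieOrbit ρ v).dualAnnihilator := by
    intro j
    rw [Submodule.mem_dualAnnihilator]
    rintro _ ⟨x, rfl⟩
    have := sum_pderiv_mul_repr_lieAct_eq_zero ρ b (p := g j) (by rw [hgf]; exact (f j).2) x v
    simp only [polyHom_apply] at this
    simp only [T, LinearEquiv.coe_coe, Module.Basis.constr_apply_fintype, smul_eq_mul]
    rw [← this]
    exact Finset.sum_congr rfl fun s _ => mul_comm _ _
  have h1 : LinearIndependent k fun j => (⟨_, hmem j⟩ : (lieOrbit ρ v).dualAnnihilator) :=
    .of_comp (Submodule.subtype _) hT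
  have h2 := h1.fintype_card_le_finrank
  rw [Fintype.card_fin] at h2
  have h3 := Subspace.finrank_add_finrank_dualAnnihilator_eq (lieOrbit ρ v)
  omega

/-- If the null-cone consists of finitely many orbits, its codimension is at least the number of
basic invariants. -/
theorem zdim_nullCone_add_le {l : ℕ} {f : Fin l → invariants ρ} (hf : AlgebraicIndependent k f)
    (hfin : (orbit ρ '' nullCone ρ).Finite) {n : ℕ} (e : Module.Basis (Fin n) k (lieAlg k A)) :
    zdim k (nullCone ρ) + l ≤ Module.finrank k V := by
  refine zdim_add_le_of_forall_orbit ρ hfin fun w _ => ?_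
  refine (add_le_add_left (zdim_orbit_le ρ (Module.finBasis k V) e w) _).trans ?_
  exact_mod_cast finrank_lieOrbit_add_le ρ hf w

end AlgRep

/-! ### Minors, ranks and the degeneracy loci. -/

open scoped Matrix

namespace Matrix

variable {K : Type*} [Field K] {n m t : ℕ}

theorem exists_linearIndependent_col_of_le_rank (M : Matrix (Fin n) (Fin m) K) (h : t ≤ M.rank) :
    ∃ c : Fin t → Fin m, LinearIndependent K (M.col ∘ c) := by
  obtain ⟨κ, a, ha, hsp, hli⟩ := exists_linearIndependent' K M.col
  have : Finite κ := .of_injective a ha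
  have := Fintype.ofFinite κ
  have hcard : Fintype.card κ = M.rank := by
    rw [rank_eq_finrank_span_cols, ← hsp, finrank_span_eq_card hli]
  obtain ⟨i⟩ : Nonempty (Fin t ↪ κ) := Function.Embedding.nonempty_of_card_le (by simpa [hcard])
  exact ⟨a ∘ i, hli.comp i i.injective⟩

/-- The rank of a matrix over a field is the size of its largest non-vanishing minors. -/
theorem le_rank_iff_exists_det_submatrix_ne_zero (M : Matrix (Fin n) (Fin m) K) :
    t ≤ M.rank ↔ ∃ (r : Fin t → Fin n) (c : Fin t → Fin m), (M.submatrix r c).det ≠ 0 := by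
  constructor
  · intro h
    obtain ⟨c, hc⟩ := M.exists_linearIndependent_col_of_le_rank h
    have h1 : (M.submatrix id c)ᵀ.rank = t := by
      simpa using LinearIndependent.rank_matrix (M := (M.submatrix id c)ᵀ) hc
    rw [rank_transpose] at h1
    have h2 : t ≤ (M.submatrix id c)ᵀ.rank := by rw [rank_transpose, h1]
    obtain ⟨r, hr⟩ := exists_linearIndependent_col_of_le_rank _ h2
    refine ⟨r, c, IsUnit.ne_zero ?_⟩
    rw [← isUnit_iff_isUnit_det, ← linearIndependent_rows_iff_isUnit]
    exact hr
  · rintro ⟨r, c, h⟩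
    have := rank_of_det_ne_zero h
    rw [Fintype.card_fin] at this
    exact this.symm.le.trans (rank_submatrix_le M r c)

end Matrix

namespace AlgRep

variable {k V W : Type*} [Field k] [AddCommGroup V] [Module k V] [AddCommGroup W] [Module k W]
  {m n : ℕ} (e : Module.Basis (Fin n) k W) (F : Fin m → Mor k V W)

theorem spanDim_le (v : V) : spanDim F v ≤ m := by
  have := finrank_range_le_card (R := k) fun j => (F j : V → W) v
  rwa [Fintype.card_fin] at this

theorem rank_map_coeffMatrix (v : V) :
    ((coeffMatrix e F).map (evalAt v)).rank = spanDim F v := by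
  rw [Matrix.rank_eq_finrank_span_cols, spanDim,
    ← LinearEquiv.finrank_map_eq e.equivFun, Submodule.map_span, ← Set.range_comp]
  rfl

theorem forall_mem_minorIdeal_evalAt_eq_zero_iff {t : ℕ} (v : V) :
    (∀ p ∈ minorIdeal (coeffMatrix e F) t, evalAt v p = 0) ↔ spanDim F v < t := by
  rw [← not_iff_not, not_lt, ← rank_map_coeffMatrix e,
    Matrix.le_rank_iff_exists_det_submatrix_ne_zero]
  have hdet : ∀ (r : Fin t → Fin n) (c : Fin t → Fin m),
      evalAt v ((coeffMatrix e F).submatrix r c).det =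
        (((coeffMatrix e F).map (evalAt v)).submatrix r c).det := fun r c => by
    rw [AlgHom.map_det]
    rfl
  constructor
  · intro h
    by_contra! h'
    refine h fun p hp => ?_
    have : minorIdeal (coeffMatrix e F) t ≤ RingHom.ker (evalAt (k := k) v) := by
      refine Ideal.span_le.mpr ?_
      rintro _ ⟨r, c, rfl⟩
      exact (hdet r c).trans (h' r c)
    exact this hp
  · rintro ⟨r, c, h⟩ h'
    exact h ((hdet r c).symm.trans (h' _ (Ideal.subset_span ⟨r, c, rfl⟩)))

theorem spanDim_lt_of_minorIdeal_le {t : ℕ} {Q : Ideal (PolyFun k V)}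
    (hQ : minorIdeal (coeffMatrix e F) t ≤ Q) (v : V) (hv : ∀ q ∈ Q, evalAt v q = 0) :
    spanDim F v < t :=
  (forall_mem_minorIdeal_evalAt_eq_zero_iff e F v).mp fun q hq => hv q (hQ hq)

/-- Linearly independent morphisms are linearly independent at a generic point. -/
theorem exists_mem_minorIdeal_ne_zero [IsDomain (PolyFun k V)]
    (hF : ∀ c : Fin m → PolyFun k V,
      (∀ v, ∑ j, evalAt v (c j) • (F j : V → W) v = 0) → ∀ j, c j = 0) :
    ∃ p ∈ minorIdeal (coeffMatrix e F) m, p ≠ 0 := by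
  let K := FractionRing (PolyFun k V)
  have h1 : LinearIndependent (PolyFun k V) (coeffMatrix e F).col := by
    rw [Fintype.linearIndependent_iff]
    refine fun c hc => hF c fun v => e.ext_elem fun i => ?_
    have h2 := congrArg (evalAt v) (congrFun hc i)
    simp only [Finset.sum_apply, Pi.smul_apply, smul_eq_mul, map_sum, map_mul, Pi.zero_apply,
      map_zero] at h2
    simp only [map_sum, map_smul, Finsupp.coe_finsetSum, Finset.sum_apply, Finsupp.smul_apply,
      smul_eq_mul]
    exact h2.trans (by simp)
  have h2 := h1.map' ((Algebra.linearMap (PolyFun k V) K).compLeft (Fin n))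
    (LinearMap.ker_eq_bot.mpr ((FaithfulSMul.algebraMap_injective (PolyFun k V) K).comp_left))
  -- Over the fraction field the independent columns give rank `m`, hence a non-zero `m × m` minor.
  rw [LinearIndependent.iff_fractionRing (PolyFun k V) K] at h2
  have h3 : ((coeffMatrix e F).map (algebraMap _ K))ᵀ.rank = m := by
    simpa using LinearIndependent.rank_matrix
      (M := ((coeffMatrix e F).map (algebraMap _ K))ᵀ) h2
  rw [Matrix.rank_transpose] at h3
  obtain ⟨r, c, h⟩ := (Matrix.le_rank_iff_exists_det_submatrix_ne_zero _).mp h3.ge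
  refine ⟨_, Ideal.subset_span ⟨r, c, rfl⟩, fun h0 => h ?_⟩
  rw [Matrix.submatrix_map, ← RingHom.mapMatrix_apply, ← RingHom.map_det, h0, map_zero]

end AlgRep

/-! ### Fibre dimension, components of cones, and codimension. -/

theorem ringKrullDim_quotient_le_of_le_radical {R : Type*} [CommRing R] {I J : Ideal R}
    (h : I ≤ J.radical) : ringKrullDim (R ⧸ J) ≤ ringKrullDim (R ⧸ I) := by
  simp only [ringKrullDim_quotient]
  have hIJ : PrimeSpectrum.zeroLocus (J : Set R) ⊆ PrimeSpectrum.zeroLocus (I : Set R) :=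
    fun P hP => h.trans (P.2.radical_le_iff.mpr hP)
  exact Order.krullDim_le_of_strictMono (Set.inclusion hIJ) fun _ _ h => h

/-- The dimension of the zero set of a prime is bounded by that of the closure of its image under
a morphism plus that of a fibre. -/
theorem ringKrullDim_quotient_le_add_of_isMaximal (k : Type*) {R S : Type*} [Field k] [CharZero k]
    [CommRing R] [IsNoetherianRing R] [CommRing S] [Algebra k S] [Algebra R S]
    [Algebra.FiniteType k S]
    (Q M : Ideal S) [Q.IsPrime] [M.IsMaximal] (hQM : Q ≤ M) :
    ringKrullDim (S ⧸ Q) ≤ ringKrullDim (R ⧸ Q.under R) +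
      ringKrullDim (S ⧸ Q ⊔ (M.under R).map (algebraMap R S)) := by
  have : IsNoetherianRing S := Algebra.FiniteType.isNoetherianRing k S
  let π := Ideal.Quotient.mk Q
  let π' := Ideal.Quotient.mk (Q.under R)
  have hM : (M.map π).IsMaximal := Ideal.IsMaximal.map_of_surjective_of_ker_le
    Ideal.Quotient.mk_surjective (by rwa [Ideal.mk_ker])
  let p := (M.map π).under (R ⧸ Q.under R)
  let I := p.map (algebraMap (R ⧸ Q.under R) (S ⧸ Q))
  -- In an affine domain every maximal ideal has full height, so the local inequality for base and
  -- fibre at the one point `M` bounds the global dimension.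
  rw [← Ideal.height_eq_ringKrullDim_of_isMaximal k (M.map π)]
  have h1 := Ideal.height_le_height_add_of_liesOver p (M.map π)
  have hI : I ≤ M.map π := Ideal.map_comap_le
  have hne : (M.map π).map (Ideal.Quotient.mk I) ≠ ⊤ := by
    have : ((M.map π).map (Ideal.Quotient.mk I)).IsMaximal :=
      Ideal.IsMaximal.map_of_surjective_of_ker_le Ideal.Quotient.mk_surjective
        (by rwa [Ideal.mk_ker])
    exact this.ne_top
  have h2 : (p.height : WithBot ℕ∞) ≤ ringKrullDim (R ⧸ Q.under R) :=
    Ideal.height_le_ringKrullDim_of_ne_top Ideal.IsPrime.ne_top'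
  have h3 := Ideal.height_le_ringKrullDim_of_ne_top hne
  have h4 : ringKrullDim ((S ⧸ Q) ⧸ I) ≤
      ringKrullDim (S ⧸ Q ⊔ (M.under R).map (algebraMap R S)) := by
    refine ringKrullDim_le_of_surjective (Ideal.Quotient.lift _
      ((Ideal.Quotient.mk I).comp π) fun a ha => ?_) (Ideal.Quotient.lift_surjective_of_surjective
        _ _ (Ideal.Quotient.mk_surjective.comp Ideal.Quotient.mk_surjective))
    have : Q ⊔ (M.under R).map (algebraMap R S) ≤ RingHom.ker ((Ideal.Quotient.mk I).comp π) := by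
      refine sup_le (fun q hq => ?_) (Ideal.map_le_iff_le_comap.mpr fun r hr => ?_)
      · rw [RingHom.mem_ker, RingHom.comp_apply, Ideal.Quotient.eq_zero_iff_mem.mpr hq, map_zero]
      · rw [Ideal.mem_comap, RingHom.mem_ker, RingHom.comp_apply, Ideal.Quotient.eq_zero_iff_mem]
        exact Ideal.mem_map_of_mem (algebraMap (R ⧸ Q.under R) (S ⧸ Q)) (x := π' r)
          (Ideal.mem_map_of_mem π hr)
    exact this ha
  calc ((M.map π).height : WithBot ℕ∞)
      ≤ p.height + ((M.map π).map (Ideal.Quotient.mk I)).height := by exact_mod_cast h1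
    _ ≤ _ := add_le_add h2 (h3.trans h4)

/-- The family of homotheties `p ↦ p (x T)`, where `T` is an indeterminate. -/
def MvPolynomial.homothetyHom {k σ B : Type*} [CommRing k] [CommRing B] [Algebra k B] (x : σ → B) :
    MvPolynomial σ k →ₐ[k] Polynomial B :=
  MvPolynomial.aeval fun i => Polynomial.C (x i) * Polynomial.X

theorem MvPolynomial.eval_homothetyHom {k σ B : Type*} [CommRing k] [CommRing B] [Algebra k B]
    (x : σ → B) (t : k) (p : MvPolynomial σ k) :
    (homothetyHom x p).eval (algebraMap k B t) = aeval (t • x) p := by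
  have : ((Polynomial.aeval (R := B) (algebraMap k B t)).restrictScalars k).comp
      (homothetyHom x) = aeval (t • x) := by
    ext i
    rw [AlgHom.comp_apply, homothetyHom, aeval_X, AlgHom.restrictScalars_apply, map_mul,
      Polynomial.aeval_C, Polynomial.aeval_X, aeval_X, Pi.smul_apply, Algebra.smul_def, mul_comm]
    rfl
  rw [← this]
  simp [Polynomial.coe_aeval_eq_eval]

/-- Sweeping a component by homotheties gives an irreducible set: the kernel of `p ↦ p(xT)` into `(S
⧸ Q)[T]` is prime. It contains `I`, since a polynomial with infinitely many roots vanishes, and lies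
in `Q` by `T = 1`. Minimality makes it equal to `Q`, and `T = 0` concludes. -/
theorem Ideal.apply_zero_mem_of_mem_minimalPrimes {k S σ : Type*} [Field k] [Infinite k]
    [CommRing S] [Algebra k S] (u : MvPolynomial σ k ≃ₐ[k] S) (τ : k → S →ₐ[k] S)
    (hτ : ∀ t i, τ t (u (MvPolynomial.X i)) = t • u (MvPolynomial.X i)) {I Q : Ideal S}
    (hQ : Q ∈ I.minimalPrimes) (hI : ∀ t ≠ 0, ∀ p ∈ I, τ t p ∈ Q) {p : S} (hp : p ∈ Q) :
    τ 0 p ∈ Q := by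
  have : Q.IsPrime := hQ.1.1
  let x : σ → S ⧸ Q := fun i => Ideal.Quotient.mk Q (u (MvPolynomial.X i))
  let Φ : S →ₐ[k] Polynomial (S ⧸ Q) := (MvPolynomial.homothetyHom x).comp u.symm.toAlgHom
  have hΦ : ∀ (t : k) q, (Φ q).eval (algebraMap k (S ⧸ Q) t) = Ideal.Quotient.mk Q (τ t q) := by
    intro t q
    have : MvPolynomial.aeval (t • x) =
        ((Ideal.Quotient.mkₐ k Q).comp (τ t)).comp u.toAlgHom := by
      ext i
      rw [MvPolynomial.aeval_X]
      refine Eq.trans ?_ (congrArg (Ideal.Quotient.mkₐ k Q) (hτ t i)).symm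
      exact (map_smul (Ideal.Quotient.mkₐ k Q) t _).symm
    obtain ⟨q, rfl⟩ := u.surjective q
    have h2 : Φ (u q) = MvPolynomial.homothetyHom x q :=
      congrArg (MvPolynomial.homothetyHom x) (u.symm_apply_apply q)
    rw [h2, MvPolynomial.eval_homothetyHom, this]
    rfl
  have hle : RingHom.ker Φ ≤ Q := fun q hq => by
    have h1 := hΦ 1 q
    have h2 : (τ 1).comp u.toAlgHom = u.toAlgHom := by
      ext i
      exact (hτ 1 i).trans (one_smul k _)
    have h3 : τ 1 q = q := by
      obtain ⟨q, rfl⟩ := u.surjective q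
      exact DFunLike.congr_fun h2 q
    rw [(RingHom.mem_ker.mp hq), Polynomial.eval_zero, h3] at h1
    exact Ideal.Quotient.eq_zero_iff_mem.mp h1.symm
  have hIΦ : I ≤ RingHom.ker Φ := by
    intro q hq
    refine Polynomial.eq_zero_of_infinite_isRoot _ (Set.Infinite.mono
      (s := algebraMap k (S ⧸ Q) '' {0}ᶜ) ?_ ?_)
    · rintro _ ⟨t, ht, rfl⟩
      change (Φ q).eval _ = 0
      rw [hΦ, Ideal.Quotient.eq_zero_iff_mem]
      exact hI t ht q hq
    · exact (Set.Finite.infinite_compl (Set.finite_singleton 0)).image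
        (algebraMap k (S ⧸ Q)).injective.injOn
  have hp' : p ∈ RingHom.ker Φ := hQ.2 ⟨RingHom.ker_isPrime Φ, hIΦ⟩ hle hp
  have h1 := hΦ 0 p
  rw [(RingHom.mem_ker.mp hp'), Polynomial.eval_zero] at h1
  exact Ideal.Quotient.eq_zero_iff_mem.mp h1.symm

namespace AlgRep

section Codim

variable {k V : Type*} [Field k] [AddCommGroup V] [Module k V]

/-- Only positive bounds translate: `codim` is a supremum in `ℕ∞`, so it is at least `0` even when
`dim Y > dim X`. -/
theorem natCast_succ_le_codim_iff (X Y : Set V) (c : ℕ) :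
    ((c + 1 : ℕ) : ℕ∞) ≤ codim k X Y ↔ zdim k Y + ((c + 1 : ℕ) : WithBot ℕ∞) ≤ zdim k X := by
  refine ⟨fun h => ?_, fun h => le_iSup₂_of_le (c + 1) h le_rfl⟩
  by_contra hc
  have h1 : codim k X Y ≤ (c : ℕ∞) := by
    refine iSup₂_le fun d hd => Nat.cast_le.mpr ?_
    by_contra! hcd
    refine hc (le_trans ?_ hd)
    gcongr
    exact_mod_cast hcd
  exact absurd (Nat.cast_le.mp (h.trans h1)) (by omega)

theorem zdim_nonneg {X : Set V} (hX : X.Nonempty) : 0 ≤ zdim k X := by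
  obtain ⟨v, hv⟩ := hX
  have : Nontrivial (PolyFun k V ⧸ vanishing k X) := by
    refine Ideal.Quotient.nontrivial_iff.mpr fun h => ?_
    have h1 : (1 : PolyFun k V) ∈ vanishing k X := h ▸ Submodule.mem_top
    exact one_ne_zero (α := k) (h1 v hv)
  exact ringKrullDim_nonneg_of_nontrivial

theorem _root_.WithBot.exists_natCast_of_nonneg_of_le {x : WithBot ℕ∞} {N : ℕ} (h0 : 0 ≤ x)
    (h : x ≤ N) : ∃ d : ℕ, x = d := by
  induction x with
  | bot => simp at h0
  | coe x =>
    have : x ≤ N := by exact_mod_cast h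
    obtain ⟨d, rfl⟩ := ENat.ne_top_iff_exists.mp (ne_top_of_le_ne_top (ENat.natCast_ne_top N) this)
    exact ⟨d, rfl⟩

theorem exists_zdim_eq_natCast [FiniteDimensional k V] [Infinite k] {X : Set V}
    (hX : X.Nonempty) : ∃ d : ℕ, zdim k X = d :=
  WithBot.exists_natCast_of_nonneg_of_le (zdim_nonneg hX) (zdim_le_finrank X)

end Codim

section Scale

variable {k V : Type*} [Field k] [AddCommGroup V] [Module k V]

/-- The action of a homothety on polynomial functions. -/
def scaleHom (t : k) : PolyFun k V →ₐ[k] PolyFun k V where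
  toFun p := ⟨fun v => (p : V → k) (t • v), by
    refine Algebra.adjoin_induction (p := fun q _ => (fun v => q (t • v)) ∈ PolyFun k V)
      ?_ ?_ ?_ ?_ p.2
    · rintro _ ⟨L, rfl⟩
      exact Algebra.subset_adjoin ⟨t • L, by ext v; simp⟩
    · exact fun c => (PolyFun k V).algebraMap_mem c
    · exact fun _ _ _ _ hp hq => add_mem hp hq
    · exact fun _ _ _ _ hp hq => mul_mem hp hq⟩
  map_one' := rfl
  map_mul' _ _ := rfl
  map_zero' := rfl
  map_add' _ _ := rfl
  commutes' _ := rfl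

variable [FiniteDimensional k V]

/-- A component of a cone contains the origin. -/
theorem evalAt_zero_eq_zero_of_mem_minimalPrimes [IsAlgClosed k] {I Q : Ideal (PolyFun k V)}
    (hQ : Q ∈ I.minimalPrimes)
    (hI : ∀ v, (∀ p ∈ I, evalAt v p = 0) → ∀ t : k, t ≠ 0 → ∀ p ∈ I, evalAt (t • v) p = 0)
    {p : PolyFun k V} (hp : p ∈ Q) : evalAt 0 p = 0 := by
  have : Infinite k := IsAlgClosed.instInfinite
  have : Q.IsPrime := hQ.1.1
  let b := Module.finBasis k V
  have h := Ideal.apply_zero_mem_of_mem_minimalPrimes (polyEquiv b) scaleHom (fun t i => by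
    ext v
    change evalAt (t • v) (polyHom b (MvPolynomial.X i)) =
      t * evalAt v (polyHom b (MvPolynomial.X i))
    rw [polyHom, MvPolynomial.aeval_X]
    exact map_smul (b.coord i) t v) hQ (fun t ht q hq => by
      rw [← vanishing_setOf_eq Q]
      exact fun v hv => hI v (fun p hp => hv p (hQ.1.2 hp)) t ht q hq) hp
  -- Scaling by zero turns `p` into the constant `p(0)`, and a proper ideal contains no non-zero
  -- constant.
  have h2 : scaleHom 0 p = algebraMap k _ (evalAt 0 p) := by
    ext v
    exact congrArg p.1 (zero_smul k v)
  rw [h2] at h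
  by_contra h0
  exact this.ne_top (Ideal.eq_top_of_isUnit_mem _ h ((IsUnit.mk0 _ h0).map _))

theorem evalAt_zero_eq_zero_of_mem_minimalPrimes_minorIdeal [IsAlgClosed k] {W : Type*}
    [AddCommGroup W] [Module k W] {m n t : ℕ} (e : Module.Basis (Fin n) k W) {F : Fin m → Mor k V W}
    (hF : ∀ c : k, c ≠ 0 → ∀ v, spanDim F (c • v) ≤ spanDim F v) {Q : Ideal (PolyFun k V)}
    (hQ : Q ∈ (minorIdeal (coeffMatrix e F) t).minimalPrimes) (q : PolyFun k V) (hq : q ∈ Q) :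
    evalAt 0 q = 0 :=
  evalAt_zero_eq_zero_of_mem_minimalPrimes hQ (fun v hv c hc => by
    rw [forall_mem_minorIdeal_evalAt_eq_zero_iff] at hv ⊢
    exact (hF c hc v).trans_lt hv) hq

end Scale

end AlgRep

theorem Ideal.le_height_of_forall_mem_minimalPrimes {R : Type*} [CommRing R] {I : Ideal R} {c : ℕ∞}
    (h : ∀ Q ∈ I.minimalPrimes, c ≤ Q.height) : c ≤ I.height := by
  rw [Ideal.height_eq_inf_minimalPrimes]
  exact le_iInf₂ h

theorem AlgHom.eq_of_ker_le {k B : Type*} [CommRing k] [Ring B] [Algebra k B] {φ ψ : B →ₐ[k] k}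
    (h : ∀ b, φ b = 0 → ψ b = 0) : φ = ψ := by
  ext b
  have h1 := h (b - algebraMap k B (φ b)) (by simp)
  rw [map_sub, AlgHom.commutes, sub_eq_zero] at h1
  exact h1.symm

/-! ### The kernel of `φ̂` and the orbitwise form of the codimension condition. -/

namespace AlgRep

variable {k A V : Type*} [Field k] [CommRing A] [HopfAlgebra k A] [AddCommGroup V] [Module k V]
  (ρ : RationalRep k A V)

section Kernel

variable [FiniteDimensional k V] {m : ℕ}
  (F : Module.Basis (Fin m) (PolyFun k V) (LinearMap.ker (phiHat ρ)))

theorem ker_apply_eq_sum (H : LinearMap.ker (phiHat ρ)) (v : V) :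
    H.1.1 v = ∑ j, evalAt v (F.repr H j) • (F j).1.1 v := by
  let E : LinearMap.ker (phiHat ρ) →+ lieAlg k A :=
    { toFun := fun H => H.1.1 v, map_zero' := rfl, map_add' := fun _ _ => rfl }
  have h1 := congrArg E (F.sum_repr H)
  rw [map_sum] at h1
  exact h1.symm

theorem apply_mem_span_of_mem_ker {G : Mor k V (lieAlg k A)} (hG : G ∈ LinearMap.ker (phiHat ρ))
    (v : V) : G.1 v ∈ Submodule.span k (Set.range fun j => (F j).1.1 v) := by
  rw [ker_apply_eq_sum ρ F ⟨G, hG⟩ v]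
  exact sum_mem fun j _ => Submodule.smul_mem _ _ (Submodule.subset_span ⟨j, rfl⟩)

theorem forall_eq_zero_of_sum_smul_eq_zero (c : Fin m → PolyFun k V)
    (h : ∀ v, ∑ j, evalAt v (c j) • (F j).1.1 v = 0) (j : Fin m) : c j = 0 := by
  have hc : ∀ j, F.repr (F.equivFun.symm c) j = c j :=
    fun j => congrFun (F.equivFun.apply_symm_apply c) j
  have h0 : F.equivFun.symm c = 0 := by
    refine Subtype.ext (Subtype.ext (funext fun v => ?_))
    rw [ker_apply_eq_sum ρ F]
    simp only [hc]
    exact h v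
  exact congrFun (F.equivFun.symm.map_eq_zero_iff.mp h0) j

/-- The strata of the kernel of `φ̂` are cones. -/
theorem spanDim_smul_le {t : k} (ht : t ≠ 0) (v : V) :
    spanDim (fun j => (F j).1) (t • v) ≤ spanDim (fun j => (F j).1) v := by
  have := FiniteDimensional.span_of_finite k (Set.finite_range fun j => (F j).1.1 v)
  refine Submodule.finrank_mono (Submodule.span_le.mpr ?_)
  rintro _ ⟨j, rfl⟩
  -- The rescaled morphism `v ↦ F_j(t v)` is again in the kernel, because `F_j(tv) · tv = 0` and `t
  -- ≠ 0`; its values therefore lie in the span of the basis at `v`.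
  let G : Mor k V (lieAlg k A) :=
    ⟨fun v => (F j).1.1 (t • v), fun L => (scaleHom t ⟨_, (F j).1.2 L⟩).2⟩
  refine apply_mem_span_of_mem_ker ρ F (G := G) (Subtype.ext (funext fun v => ?_)) v
  have h : lieAct ρ ((F j).1.1 (t • v)) (t • v) = 0 :=
    congrFun (congrArg Subtype.val (LinearMap.mem_ker.mp (F j).2)) (t • v)
  rw [map_smul] at h
  exact (smul_eq_zero.mp h).resolve_left ht

end Kernel

section Regular

variable {m : ℕ} {F : Fin m → Mor k V (lieAlg k A)}

theorem zdim_nullCone_eq_of_mem_regularPoints (hfin : (orbit ρ '' nullCone ρ).Finite) {v : V}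
    (hv : v ∈ regularPoints ρ (nullCone ρ)) : zdim k (nullCone ρ) = zdim k (orbit ρ v) := by
  refine le_antisymm ?_ (zdim_mono (orbit_subset_nullCone ρ hv.1))
  have := zdim_add_le_of_forall_orbit ρ hfin (c := 0) (D := zdim k (orbit ρ v)) fun w hw => by
    rw [add_zero]
    exact hv.2 w hw
  rwa [add_zero] at this

/-- By equivariance the stratum is a union of orbits, finitely many, so its dimension is that of its
largest orbit. -/
theorem nullStratum_codim_iff (hF : ∀ j, IsEquivariant ρ (F j))
    (hfin : (orbit ρ '' nullCone ρ).Finite) (i : ℕ) :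
    ((i + 1 : ℕ) : ℕ∞) ≤ codim k (nullCone ρ) (nullStratum ρ F i) ↔
      ∀ v ∈ nullStratum ρ F i, ((i + 1 : ℕ) : ℕ∞) ≤ codim k (nullCone ρ) (orbit ρ v) := by
  simp only [natCast_succ_le_codim_iff]
  constructor
  · intro h v hv
    refine le_trans (add_le_add_left (zdim_mono ?_) _) h
    rintro _ ⟨g, rfl⟩
    exact ⟨by simpa only [stratum, Set.mem_ofPred_eq, spanDim_act ρ hF] using hv.1,
      orbit_subset_nullCone ρ hv.2 ⟨g, rfl⟩⟩
  · exact zdim_add_le_of_forall_orbit ρ (hfin.subset (Set.image_mono Set.inter_subset_right))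

/-- The sharpest condition at `v` is the one for `i = m - spanDim F v`. A regular orbit has the
dimension of the null-cone, which forces `i = 0`. At a non-regular point with `i = 0` the required
codimension `1` is just the failure of maximality. -/
theorem nullStratum_codim_iff_regularPoints [Infinite k] [FiniteDimensional k V]
    (hF : ∀ j, IsEquivariant ρ (F j)) (hfin : (orbit ρ '' nullCone ρ).Finite) :
    (∀ i : ℕ, 1 ≤ i → ((i + 1 : ℕ) : ℕ∞) ≤ codim k (nullCone ρ) (nullStratum ρ F i)) ↔
      (regularPoints ρ (nullCone ρ) ⊆ nullStratum ρ F 0 \ nullStratum ρ F 1 ∧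
        ∀ v ∈ nullCone ρ \ regularPoints ρ (nullCone ρ),
          ((m + 1 : ℕ) : ℕ∞) ≤ (spanDim F v : ℕ∞) + codim k (nullCone ρ) (orbit ρ v)) := by
  -- The truncated subtraction is harmless because `spanDim F v ≤ m`.
  have key : ∀ v, ((m + 1 : ℕ) : ℕ∞) ≤ (spanDim F v : ℕ∞) + codim k (nullCone ρ) (orbit ρ v) ↔
      ((m - spanDim F v + 1 : ℕ) : ℕ∞) ≤ codim k (nullCone ρ) (orbit ρ v) := by
    intro v
    have := spanDim_le F v
    generalize codim k (nullCone ρ) (orbit ρ v) = c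
    induction c with
    | top => simp
    | coe c => norm_cast; omega
  simp only [nullStratum_codim_iff ρ hF hfin, key]
  constructor
  · refine fun h => ⟨fun v hv => ⟨⟨spanDim_le F v, hv.1⟩, fun hv' => ?_⟩, fun v hv => ?_⟩
    · have h1 := h 1 le_rfl v hv'
      rw [natCast_succ_le_codim_iff, zdim_nullCone_eq_of_mem_regularPoints ρ hfin hv] at h1
      obtain ⟨d, hd⟩ := exists_zdim_eq_natCast (k := k) ⟨v, mem_orbit_self ρ v⟩
      rw [hd] at h1
      have : d + (1 + 1) ≤ d := by exact_mod_cast h1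
      omega
    · rcases Nat.eq_zero_or_pos (m - spanDim F v) with h0 | h0
      · rw [h0, natCast_succ_le_codim_iff]
        have h1 : ∃ w ∈ nullCone ρ, zdim k (orbit ρ v) < zdim k (orbit ρ w) := by
          by_contra! h1
          exact hv.2 ⟨hv.1, h1⟩
        obtain ⟨w, hw, hvw⟩ := h1
        refine le_trans ?_ (zdim_mono (orbit_subset_nullCone ρ hw))
        obtain ⟨d, hd⟩ := exists_zdim_eq_natCast (k := k) ⟨v, mem_orbit_self ρ v⟩
        obtain ⟨d', hd'⟩ := exists_zdim_eq_natCast (k := k) ⟨w, mem_orbit_self ρ w⟩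
        rw [hd, hd'] at hvw ⊢
        have : d < d' := by exact_mod_cast hvw
        exact_mod_cast this
      · refine h _ h0 v ⟨?_, hv.1⟩
        have := spanDim_le F v
        change spanDim F v + (m - spanDim F v) ≤ m
        omega
  · rintro ⟨h1, h2⟩ i hi v hv
    have hvi : spanDim F v + i ≤ m := hv.1
    refine le_trans ?_ (h2 v ⟨hv.2, fun hreg => (h1 hreg).2 ⟨?_, hv.2⟩⟩)
    · exact_mod_cast (by omega : i + 1 ≤ m - spanDim F v + 1)
    · change spanDim F v + 1 ≤ m
      omega

end Regular

/-! ### Degeneracy loci over the quotient and the height estimates. -/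

@[reducible] def invariantsCommRing : CommRing (invariants ρ) := (invariants ρ).toCommRing

section Height

attribute [local instance] invariantsCommRing

variable [IsAlgClosed k] [CharZero k] [FiniteDimensional k V] {l : ℕ} {f : Fin l → invariants ρ}

omit [IsAlgClosed k] [CharZero k] [FiniteDimensional k V] in
theorem finiteType_invariants (hgen : Algebra.adjoin k (Set.range f) = ⊤) :
    Algebra.FiniteType k (invariants ρ) :=
  ⟨⟨(Set.finite_range f).toFinset, by rw [Set.Finite.coe_toFinset, hgen]⟩⟩

omit [IsAlgClosed k] [CharZero k] [FiniteDimensional k V] in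
theorem ringKrullDim_invariants (hf : AlgebraicIndependent k f)
    (hgen : Algebra.adjoin k (Set.range f) = ⊤) : ringKrullDim (invariants ρ) = l := by
  rw [← MvPolynomial.ringKrullDim_fin k l]
  exact (ringKrullDim_eq_of_ringEquiv
    (hf.aevalEquiv.trans
      ((Subalgebra.equivOfEq _ _ hgen).trans Subalgebra.topEquiv)).toRingEquiv).symm

omit [CharZero k] in
/-- If generic fibres of the quotient map are orbits, an irreducible set along which a generically
independent family of morphisms with invariant rank degenerates does not dominate the quotient. -/
theorem exists_invariant_ne_zero_mem_of_degenerate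
    [Algebra.FiniteType k (invariants ρ)] {m n : ℕ} {W : Type*} [AddCommGroup W] [Module k W]
    {F : Fin m → Mor k V W}
    (hF : ∀ g v, spanDim F (act ρ g v) = spanDim F v) (e : Module.Basis (Fin n) k W)
    (hgen : GenericFibreIsOrbit ρ) {p : PolyFun k V} (hp : p ∈ minorIdeal (coeffMatrix e F) m)
    (hp0 : p ≠ 0) (Q : Ideal (PolyFun k V)) [Q.IsPrime]
    (hQ : ∀ v, (∀ q ∈ Q, evalAt v q = 0) → spanDim F v < m) :
    ∃ r : invariants ρ, r ≠ 0 ∧ (r : PolyFun k V) ∈ Q := by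
  have : Infinite k := IsAlgClosed.instInfinite
  obtain ⟨Z, ⟨T, rfl⟩, hZ, horb⟩ := hgen
  obtain ⟨v₀, hv₀⟩ := (Set.ne_univ_iff_exists_notMem _).mp hZ
  simp only [Set.mem_ofPred_eq, not_forall] at hv₀
  obtain ⟨z, hzT, hz⟩ := hv₀
  have hz0 : z ≠ 0 := fun h => hz (by rw [h]; rfl)
  by_contra! hcon
  have : IsNoetherianRing (invariants ρ) :=
    Algebra.FiniteType.isNoetherianRing k (invariants ρ)
  have : Algebra.FiniteType (invariants ρ) (PolyFun k V) :=
    .of_restrictScalars_finiteType k _ _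
  have : Algebra.FinitePresentation (invariants ρ) (PolyFun k V) := 
    Algebra.FinitePresentation.of_finiteType.mp ‹_›
  have : FaithfulSMul (invariants ρ) (PolyFun k V) :=
    (faithfulSMul_iff_algebraMap_injective _ _).mpr Subtype.val_injective
  obtain ⟨h, hh, H⟩ := exists_ne_zero_forall_prime_exists_liesOver (R := invariants ρ)
    (mul_ne_zero hp0 hz0)
  -- If `Q` met the invariants only in zero, some `y` in its zero set would have `h(y) ≠ 0`. The
  -- fibre through `y` then contains a point `v` of full rank whose fibre is an orbit, so `y ∈ G ·
  -- v` has full rank too.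
  obtain ⟨y, hyQ, hy⟩ := exists_apply_ne_zero Q (hcon h hh)
  obtain ⟨q, hq, hsq, hqy⟩ := H (RingHom.ker (quotientMap ρ y)) (RingHom.ker_isPrime _) hy
  obtain ⟨v, hvq, hv⟩ := exists_apply_ne_zero q hsq
  have hv' : evalAt v p * evalAt v z ≠ 0 := hv
  have hvy : quotientMap ρ y = quotientMap ρ v :=
    AlgHom.eq_of_ker_le (B := invariants ρ) fun r hr => hvq _ (hqy.ge hr)
  have hyv : y ∈ orbit ρ v := by
    rw [← horb v fun hvT => right_ne_zero_of_mul hv' (hvT z hzT)]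
    exact hvy
  obtain ⟨g, rfl⟩ := hyv
  have h1 := hQ _ hyQ
  rw [hF, ← forall_mem_minorIdeal_evalAt_eq_zero_iff e] at h1
  exact left_ne_zero_of_mul hv' (h1 p hp)

omit [CharZero k] in
-- A common zero of `Q` and of the invariants vanishing at the origin lies in the null-cone. Hence
-- the possibly non-reduced fibre over `π_V(0)` has dimension at most that of the reduced
-- intersection.
theorem vanishing_inter_nullCone_le_radical (Q : Ideal (PolyFun k V)) :
    vanishing k ({v | ∀ q ∈ Q, evalAt v q = 0} ∩ nullCone ρ) ≤
      (Q ⊔ ((RingHom.ker (evalAt (k := k) (0 : V))).under (invariants ρ)).map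
        (algebraMap (invariants ρ) (PolyFun k V))).radical := by
  rw [Ideal.radical_eq_sInf]
  refine le_sInf fun P ⟨hQP, hP⟩ => ?_
  rw [← vanishing_setOf_eq P]
  refine vanishing_anti fun v hv => ⟨fun q hq => hv q (hQP (Ideal.mem_sup_left hq)), ?_⟩
  exact (AlgHom.eq_of_ker_le (B := invariants ρ) (φ := quotientMap ρ 0) fun r hr =>
    hv _ (hQP (Ideal.mem_sup_right (Ideal.mem_map_of_mem _ hr)))).symm

/-- An irreducible closed set through the origin which does not dominate the quotient has
codimension at least `1 + codim N - l + codim_N (Z ∩ N)`. -/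
theorem add_two_le_height (hf : AlgebraicIndependent k f)
    (hgen : Algebra.adjoin k (Set.range f) = ⊤)
    (hN : zdim k (nullCone ρ) + l ≤ Module.finrank k V) (Q : Ideal (PolyFun k V)) [Q.IsPrime]
    (hQ0 : ∀ q ∈ Q, evalAt 0 q = 0) {r : invariants ρ} (hr : r ≠ 0) (hrQ : (r : PolyFun k V) ∈ Q)
    (i : ℕ) (hi : zdim k ({v | ∀ q ∈ Q, evalAt v q = 0} ∩ nullCone ρ) + ((i + 1 : ℕ) : WithBot ℕ∞)
      ≤ zdim k (nullCone ρ)) :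
    ((i + 2 : ℕ) : ℕ∞) ≤ Q.height := by
  have : Infinite k := IsAlgClosed.instInfinite
  have := finiteType_invariants ρ hgen
  have : IsNoetherianRing (invariants ρ) :=
    Algebra.FiniteType.isNoetherianRing k (invariants ρ)
  let M := RingHom.ker (evalAt (k := k) (0 : V))
  have hM : M.IsMaximal := RingHom.ker_isMaximal_of_surjective _ fun c =>
    ⟨algebraMap k _ c, AlgHom.commutes _ c⟩
  have h1 := ringKrullDim_quotient_le_add_of_isMaximal k (R := invariants ρ) Q M hQ0
  have h2 := ringKrullDim_quotient_le_of_le_radical (vanishing_inter_nullCone_le_radical ρ Q)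
  -- The non-zero invariant `r` cuts the closure of the image down to dimension at most `l - 1`.
  have h3 : ringKrullDim (invariants ρ ⧸ Q.under (invariants ρ)) + 1 ≤ l := by
    rw [← ringKrullDim_invariants ρ hf hgen]
    refine le_trans (add_le_add_left (ringKrullDim_le_of_surjective (Ideal.Quotient.factor
      (S := Ideal.span {r}) ((Ideal.span_singleton_le_iff_mem _).mpr hrQ))
      (Ideal.Quotient.factor_surjective _)) 1)
      (ringKrullDim_quotient_succ_le_of_nonZeroDivisor (mem_nonZeroDivisors_of_ne_zero hr))
  have h4 := finrank_le_height_add_ringKrullDim Q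
  have hne : ({v | ∀ q ∈ Q, evalAt v q = 0} ∩ nullCone ρ).Nonempty := ⟨0, hQ0, rfl⟩
  obtain ⟨a, ha⟩ := exists_zdim_eq_natCast (k := k) hne
  obtain ⟨b, hb⟩ := exists_zdim_eq_natCast (k := k) (X := nullCone ρ) ⟨0, rfl⟩
  have : Nontrivial (invariants ρ ⧸ Q.under (invariants ρ)) :=
    Ideal.Quotient.nontrivial_iff.mpr Ideal.IsPrime.ne_top'
  obtain ⟨c, hc⟩ : ∃ c : ℕ, ringKrullDim (invariants ρ ⧸ Q.under (invariants ρ)) = c :=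
    WithBot.exists_natCast_of_nonneg_of_le ringKrullDim_nonneg_of_nontrivial
      (le_trans (le_add_of_nonneg_right zero_le_one) h3)
  change _ ≤ zdim k _ at h2
  have h5 : ringKrullDim (PolyFun k V ⧸ Q) ≤ ((c + a : ℕ) : WithBot ℕ∞) := by
    rw [Nat.cast_add, ← hc, ← ha]
    exact h1.trans (add_le_add_right h2 _)
  rw [hb] at hN hi
  rw [ha] at hi
  rw [hc] at h3
  have h6 : b + l ≤ Module.finrank k V := by exact_mod_cast hN
  have h7 : a + (i + 1) ≤ b := by exact_mod_cast hi
  have h8 : c + 1 ≤ l := by exact_mod_cast h3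
  have h9 : (Module.finrank k V : WithBot ℕ∞) ≤ Q.height + ((c + a : ℕ) : WithBot ℕ∞) :=
    h4.trans (add_le_add_right h5 _)
  generalize Q.height = x at h9
  induction x with
  | top => exact le_top
  | coe x =>
    have h10 : Module.finrank k V ≤ x + (c + a) := by exact_mod_cast h9
    exact_mod_cast (by omega : i + 2 ≤ x)

/-- A component of a proper degeneracy locus has the expected codimension if the degeneracy locus
on the null-cone has. -/
theorem add_two_le_height_of_mem_minimalPrimes_minorIdeal (hf : AlgebraicIndependent k f)
    (hgen : Algebra.adjoin k (Set.range f) = ⊤)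
    (hN : zdim k (nullCone ρ) + l ≤ Module.finrank k V) (hgeneric : GenericFibreIsOrbit ρ)
    {m n : ℕ} {W : Type*} [AddCommGroup W] [Module k W]
    {F : Fin m → Mor k V W} (hF : ∀ g v, spanDim F (act ρ g v) = spanDim F v)
    (hcone : ∀ t : k, t ≠ 0 → ∀ v, spanDim F (t • v) ≤ spanDim F v)
    (e : Module.Basis (Fin n) k W) {p : PolyFun k V}
    (hp : p ∈ minorIdeal (coeffMatrix e F) m) (hp0 : p ≠ 0) {i t : ℕ} (hit : t + i = m + 1)
    (hi : 1 ≤ i)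
    (hcodim : zdim k (nullStratum ρ F i) + ((i + 1 : ℕ) : WithBot ℕ∞) ≤ zdim k (nullCone ρ))
    {Q : Ideal (PolyFun k V)} (hQ : Q ∈ (minorIdeal (coeffMatrix e F) t).minimalPrimes) :
    ((i + 2 : ℕ) : ℕ∞) ≤ Q.height := by
  have htm : t ≤ m := by omega
  -- Vanishing `t × t` minors mean rank at most `t - 1 = m - i`, so the zero set of `Q` lies in the
  -- stratum of index `i`.
  have hst : ∀ s, s < t → s + i ≤ m := fun s hs => by omega
  have := finiteType_invariants ρ hgen
  have hQp : Q.IsPrime := Ideal.IsMinimalPrime.isPrime hQ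
  have hle : minorIdeal (coeffMatrix e F) t ≤ Q := Ideal.IsMinimalPrime.le hQ
  have hspan := spanDim_lt_of_minorIdeal_le e F hle
  obtain ⟨r, hr, hrQ⟩ := exists_invariant_ne_zero_mem_of_degenerate ρ hF e hgeneric hp hp0 Q
    fun v hv => (hspan v hv).trans_le htm
  have hQ0 := evalAt_zero_eq_zero_of_mem_minimalPrimes_minorIdeal e hcone hQ
  refine add_two_le_height ρ hf hgen hN Q hQ0 hr hrQ i
    (le_trans (add_le_add_left (zdim_mono ?_) _) hcodim)
  exact Set.inter_subset_inter_left _ fun v hv => hst _ (hspan v hv)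

/-- The height estimates for the determinantal ideals of a family of morphisms follow
from codimension estimates on the null-cone. -/
theorem conditionF_two_of_codim_nullStratum (hf : AlgebraicIndependent k f)
    (hgen : Algebra.adjoin k (Set.range f) = ⊤)
    (hN : zdim k (nullCone ρ) + l ≤ Module.finrank k V) (hgeneric : GenericFibreIsOrbit ρ)
    {m n : ℕ} {W : Type*} [AddCommGroup W] [Module k W]
    {F : Fin m → Mor k V W} (hF : ∀ g v, spanDim F (act ρ g v) = spanDim F v)
    (hlin : ∀ c : Fin m → PolyFun k V,
      (∀ v, ∑ j, evalAt v (c j) • (F j).1 v = 0) → ∀ j, c j = 0)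
    (hcone : ∀ t : k, t ≠ 0 → ∀ v, spanDim F (t • v) ≤ spanDim F v)
    (e : Module.Basis (Fin n) k W)
    (hcodim : ∀ i : ℕ, 1 ≤ i →
      ((i + 1 : ℕ) : ℕ∞) ≤ codim k (nullCone ρ) (nullStratum ρ F i)) :
    ConditionF 2 (coeffMatrix e F) := by
  intro t ht htm
  have : Infinite k := IsAlgClosed.instInfinite
  obtain ⟨p, hp, hp0⟩ := exists_mem_minorIdeal_ne_zero e F hlin
  -- The unit ideal has no minimal primes, so its infinite height needs no separate case.
  refine Ideal.le_height_of_forall_mem_minimalPrimes fun Q hQ => ?_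
  -- The index is `i = m - t + 1`, for which `i + 2 = m - t + 3`; it is at least `1`, as the
  -- hypothesis on the strata demands.
  exact add_two_le_height_of_mem_minimalPrimes_minorIdeal ρ hf hgen hN hgeneric hF hcone e hp hp0
    (by omega) (by omega)
    ((natCast_succ_le_codim_iff _ _ _).mp (hcodim (m - t + 1) (by omega))) hQ

end Height

end AlgRep

end

theorem proposition4p5
    {k : Type*} [Field k] [IsAlgClosed k] [CharZero k]
    -- the connected affine algebraic group `G`, with `A = k[G]`
    {A : Type*} [CommRing A] [HopfAlgebra k A] [Algebra.FiniteType k A] [IsReduced A]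
    [ConnectedSpace (PrimeSpectrum A)]
    -- the finite-dimensional rational `G`-module `V`
    {V : Type*} [AddCommGroup V] [Module k V] [FiniteDimensional k V] (ρ : RationalRep k A V)
    -- `k[V]^G` is a polynomial algebra freely generated by `f₁, …, f_l`
    {l : ℕ} (f : Fin l → invariants ρ) (_hf : AlgebraicIndependent k f)
    (_hgen : Algebra.adjoin k (Set.range f) = ⊤)
    -- `Ker φ̂` is a free `k[V]`-module with a basis of `G`-equivariant morphisms
    {m : ℕ} (F : Module.Basis (Fin m) (PolyFun k V) (LinearMap.ker (phiHat ρ)))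
    (_hF : ∀ j, IsEquivariant ρ (F j))
    -- a generic fibre of `π_V` is an orbit; the null-cone consists of finitely many orbits
    (_hgeneric : GenericFibreIsOrbit ρ)
    (_hfin : (orbit ρ '' nullCone ρ).Finite)
    -- a basis of the Lie algebra, used to write `F₁, …, F_m` as an `n × m` matrix
    {n : ℕ} (e : Module.Basis (Fin n) k (lieAlg k A)) :
    ((∀ i : ℕ, 1 ≤ i →
        ((i + 1 : ℕ) : ℕ∞) ≤
          codim k (nullCone ρ) (nullStratum ρ (fun j => (F j).1) i)) →
      ConditionF 2 (coeffMatrix e fun j => (F j).1)) ∧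
    ((∀ i : ℕ, 1 ≤ i →
        ((i + 1 : ℕ) : ℕ∞) ≤
          codim k (nullCone ρ) (nullStratum ρ (fun j => (F j).1) i)) ↔
      (regularPoints ρ (nullCone ρ) ⊆
          nullStratum ρ (fun j => (F j).1) 0 \ nullStratum ρ (fun j => (F j).1) 1 ∧
        ∀ v ∈ nullCone ρ \ regularPoints ρ (nullCone ρ),
          ((m + 1 : ℕ) : ℕ∞) ≤
            (spanDim (fun j => (F j).1) v : ℕ∞) + codim k (nullCone ρ) (orbit ρ v))) := by
  have : Infinite k := IsAlgClosed.instInfinite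
  exact ⟨conditionF_two_of_codim_nullStratum ρ _hf _hgen (zdim_nullCone_add_le ρ _hf _hfin e)
    _hgeneric (spanDim_act ρ _hF)
    (forall_eq_zero_of_sum_smul_eq_zero ρ F) (fun _ ht v => spanDim_smul_le ρ F ht v)
    e, nullStratum_codim_iff_regularPoints ρ _hF _hfin⟩
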